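/- Let $k\ge 1$, let $\mu_1,\dots,\mu_n$ be probability distributions on $\mathbb{R}^d$ describing $n$ independent uncertain points, let $\mu_P=\mu_1\times\dots\times\mu_n$ on $(\mathbb{R}^d)^n$, and let $f:(\mathbb{R}^d)^n\to\mathbb{R}^k$ be a ($\mu_P$-measurable) $k$-variate statistic. For $p,v\in\mathbb{R}^k$ write $p\preceq v$ if $p_i\le v_i$ for every coordinate $i$, and let $F_{\mu_P}(v)=\Pr_{Q\sim\mu_P}[f(Q)\preceq v]$. A $k$-variate $\varepsilon$-quantization of $F_{\mu_P}$ is a nonempty finite point (multi)set $R\subset\mathbb{R}^k$ such that $$\left|\frac{|\{r\in R: r\preceq v\}|}{|R|}-F_{\mu_P}(v)\right|\le\varepsilon\qquad\text{for all } v\in\mathbb{R}^k .$$ There is a universal constant $C>0$ such that the following holds for all $n,d$, all $k\ge1$, all $\varepsilon,\delta\in(0,1)$ and all $\mu_1,\dots,\mu_n$ and $f$ as above. (1) If $m\ge C\,\frac{1}{\varepsilon^2}\left(k+\log\frac1\delta\right)$ and $Q_1,\dots,Q_m$ are drawn independently from $\mu_P$, then with probability at least $1-\delta$ the points $f(Q_1),\dots,f(Q_m)$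 form a $k$-variate $\varepsilon$-quantization of $F_{\mu_P}$. (2) Consider a real random access machine that can draw a random point from any given $\mu_i$ in one time unit and can evaluate $f$ on $n$ stored points (writing the $k$ coordinates of the value to memory) in $T_f(n)$ time units, where $T_f(n)\ge\max(n,1)$; every other elementary instruction takes one time unit. There is a single program for this machine, independent of $n,d,k,\varepsilon,\delta,\mu_1,\dots,\mu_n,f$, which receives $n,k,\varepsilon,\delta$ as input, always halts after at most $$C\,T_f(n)\,\frac1{\varepsilon^2}\left(k+\log\frac1\delta\right)$$ time units, draws at most $C\,\frac1{\varepsilon^2}\left(k+\log\frac1\delta\right)$ points from each $\mu_i$, and outputs a point (multi)set $R\subset\mathbb{R}^k$ whose size (number of stored real coordinates, $k|R|$) is at most $C\,\frac{k}{\varepsilon^2}\left(k+\log\frac1\delta\right)$, and which with probability at least $1-\delta$ is a $k$-variate $\varepsilon$-quantization of $F_{\mu_P}$. -/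

import Mathlib

open MeasureTheory

/-- The cumulative distribution function `v ↦ Pr[f(Q) ⪯ v]` of a `k`-variate statistic `f` of `n`
points of `ℝ^d`, where `Q = (q_1, …, q_n)` has independent coordinates `q_i ∼ μ i`.
The order on `Fin k → ℝ` is the coordinatewise one, that is, dominance. -/
noncomputable def statCDF {n d k : ℕ} (μ : Fin n → Measure (EuclideanSpace ℝ (Fin d)))
    (f : (Fin n → EuclideanSpace ℝ (Fin d)) → (Fin k → ℝ)) (v : Fin k → ℝ) : ℝ :=
  (Measure.pi μ).real {Q | f Q ≤ v}

/-- `h_R(v)`: the fraction of the points of `R` (counted with multiplicity) dominated by `v`. -/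
noncomputable def dominatedFraction {m k : ℕ} (R : Fin m → Fin k → ℝ) (v : Fin k → ℝ) : ℝ :=
  (Nat.card {i : Fin m // R i ≤ v} : ℝ) / m

/-- `R` is a (nonempty) `k`-variate `ε`-quantization of the function `F`. -/
def IsQuantization {m k : ℕ} (ε : ℝ) (F : (Fin k → ℝ) → ℝ) (R : Fin m → Fin k → ℝ) : Prop :=
  0 < m ∧ ∀ v : Fin k → ℝ, |dominatedFraction R v - F v| ≤ ε

/-! A real random access machine with structured control flow. It has natural number registers,
real registers, a random access memory of reals, a memory of points of `ℝ^d`, an instruction that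
draws a fresh random point from one of the input distributions, and an instruction that evaluates
the statistic `f` on the points held in the point memory. -/

namespace RealRAM

/-- The elementary instructions. The first argument is the target register, where there is one. -/
inductive Instr : Type
  | natConst (r c : ℕ)
  | natCopy (r a : ℕ)
  | natAdd (r a b : ℕ)
  | natSub (r a b : ℕ)
  | realConst (x c : ℕ)
  | realOfNat (x a : ℕ)
  | realCopy (x y : ℕ)
  | realAdd (x y z : ℕ)
  | realSub (x y z : ℕ)
  | realMul (x y z : ℕ)
  | realDiv (x y z : ℕ)
  /-- copy the memory cell with address in natural register `a` into real register `x` -/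
  | load (x a : ℕ)
  /-- copy real register `x` into the memory cell with address in natural register `a` -/
  | store (a x : ℕ)
  /-- with `j` the content of natural register `a`: draw a fresh point from the `j`-th
  distribution and store it in cell `j` of the point memory (no effect if `j ≥ n`) -/
  | sample (a : ℕ)
  /-- evaluate `f` on cells `0, …, n - 1` of the point memory, and write the `k` coordinates of
  the result into consecutive memory cells, from the address in natural register `a` on -/
  | evalStat (a : ℕ)

/-- Strict comparison of two natural registers, or of two real registers. -/
inductive Test : Type
  | natLt (a b : ℕ)
  | realLt (x y : ℕ)

inductive Prog : Type
  | instr (i : Instr)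
  | seq (p q : Prog)
  | cond (b : Test) (p q : Prog)
  | loop (b : Test) (p : Prog)

/-- Machine states; `drawn j` is the number of points drawn so far from the `j`-th distribution. -/
structure State (d : ℕ) : Type where
  nat : ℕ → ℕ
  real : ℕ → ℝ
  mem : ℕ → ℝ
  pts : ℕ → EuclideanSpace ℝ (Fin d)
  drawn : ℕ → ℕ

/-- The input is `n`, `k` (natural registers 0 and 1) and `ε`, `δ` (real registers 0 and 1);
everything else is zero. -/
def State.init (n d k : ℕ) (ε δ : ℝ) : State d where
  nat := fun r => if r = 0 then n else if r = 1 then k else 0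
  real := fun x => if x = 0 then ε else if x = 1 then δ else 0
  mem := fun _ => 0
  pts := fun _ => 0
  drawn := fun _ => 0

/-- The number of output points is read from natural register 0. -/
def State.outCard {d : ℕ} (s : State d) : ℕ := s.nat 0

/-- The output points are stored one after the other from memory cell 0 on, `k` cells each. -/
def State.out {d : ℕ} (k : ℕ) (s : State d) : Fin s.outCard → Fin k → ℝ :=
  fun i j => s.mem (i * k + j)

def Test.Holds {d : ℕ} (s : State d) : Test → Prop
  | .natLt a b => s.nat a < s.nat b
  | .realLt x y => s.real x < s.real y

/-- Effect of an instruction. The tape `ω` supplies the randomness: `ω t j` is the `t`-th point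
(from `t = 0` on) that is drawn from the `j`-th distribution. -/
noncomputable def Instr.apply {n d k : ℕ}
    (f : (Fin n → EuclideanSpace ℝ (Fin d)) → (Fin k → ℝ))
    (ω : ℕ → Fin n → EuclideanSpace ℝ (Fin d)) (s : State d) : Instr → State d
  | .natConst r c => { s with nat := Function.update s.nat r c }
  | .natCopy r a => { s with nat := Function.update s.nat r (s.nat a) }
  | .natAdd r a b => { s with nat := Function.update s.nat r (s.nat a + s.nat b) }
  | .natSub r a b => { s with nat := Function.update s.nat r (s.nat a - s.nat b) }
  | .realConst x c => { s with real := Function.update s.real x (c : ℝ) }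
  | .realOfNat x a => { s with real := Function.update s.real x (s.nat a : ℝ) }
  | .realCopy x y => { s with real := Function.update s.real x (s.real y) }
  | .realAdd x y z => { s with real := Function.update s.real x (s.real y + s.real z) }
  | .realSub x y z => { s with real := Function.update s.real x (s.real y - s.real z) }
  | .realMul x y z => { s with real := Function.update s.real x (s.real y * s.real z) }
  | .realDiv x y z => { s with real := Function.update s.real x (s.real y / s.real z) }
  | .load x a => { s with real := Function.update s.real x (s.mem (s.nat a)) }
  | .store a x => { s with mem := Function.update s.mem (s.nat a) (s.real x) }
  | .sample a =>
      if h : s.nat a < n then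
        { s with
          pts := Function.update s.pts (s.nat a) (ω (s.drawn (s.nat a)) ⟨s.nat a, h⟩)
          drawn := Function.update s.drawn (s.nat a) (s.drawn (s.nat a) + 1) }
      else s
  | .evalStat a =>
      { s with
        mem := fun c =>
          if h : s.nat a ≤ c ∧ c - s.nat a < k then
            f (fun i => s.pts i) ⟨c - s.nat a, h.2⟩
          else s.mem c }

/-- One evaluation of `f` takes `T` time units, and every other instruction takes one. -/
def Instr.cost (T : ℕ) : Instr → ℕ
  | .evalStat _ => T
  | _ => 1

/-- `Exec f T ω p s t s'`: started in state `s` with random tape `ω`, program `p` halts in state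
`s'` after exactly `t` time units. Every test that is carried out takes one time unit. -/
inductive Exec {n d k : ℕ} (f : (Fin n → EuclideanSpace ℝ (Fin d)) → (Fin k → ℝ)) (T : ℕ)
    (ω : ℕ → Fin n → EuclideanSpace ℝ (Fin d)) : Prog → State d → ℕ → State d → Prop
  | instr (i : Instr) (s : State d) : Exec f T ω (.instr i) s (i.cost T) (i.apply f ω s)
  | seq {p q : Prog} {s s' s'' : State d} {t t' : ℕ} :
      Exec f T ω p s t s' → Exec f T ω q s' t' s'' → Exec f T ω (.seq p q) s (t + t') s''
  | condTrue {b : Test} {p q : Prog} {s s' : State d} {t : ℕ} :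
      b.Holds s → Exec f T ω p s t s' → Exec f T ω (.cond b p q) s (1 + t) s'
  | condFalse {b : Test} {p q : Prog} {s s' : State d} {t : ℕ} :
      ¬ b.Holds s → Exec f T ω q s t s' → Exec f T ω (.cond b p q) s (1 + t) s'
  | loopStop {b : Test} {p : Prog} {s : State d} :
      ¬ b.Holds s → Exec f T ω (.loop b p) s 1 s
  | loopStep {b : Test} {p : Prog} {s s' s'' : State d} {t t' : ℕ} :
      b.Holds s → Exec f T ω p s t s' → Exec f T ω (.loop b p) s' t' s'' →
      Exec f T ω (.loop b p) s (1 + t + t') s''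

/-- The machine is deterministic once the random tape is fixed. -/
theorem Exec.deterministic {n d k : ℕ}
    {f : (Fin n → EuclideanSpace ℝ (Fin d)) → (Fin k → ℝ)} {T : ℕ}
    {ω : ℕ → Fin n → EuclideanSpace ℝ (Fin d)} {p : Prog} {s : State d} {t₁ t₂ : ℕ}
    {s₁ s₂ : State d} (h₁ : Exec f T ω p s t₁ s₁) (h₂ : Exec f T ω p s t₂ s₂) :
    t₁ = t₂ ∧ s₁ = s₂ := by
  induction h₁ generalizing t₂ s₂ with
  | instr i s => cases h₂; exact ⟨rfl, rfl⟩
  | seq _ _ ih ih' =>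
    cases h₂ with
    | seq g g' =>
      obtain ⟨rfl, rfl⟩ := ih g
      obtain ⟨rfl, rfl⟩ := ih' g'
      exact ⟨rfl, rfl⟩
  | condTrue hb _ ih =>
    cases h₂ with
    | condTrue _ g => obtain ⟨rfl, rfl⟩ := ih g; exact ⟨rfl, rfl⟩
    | condFalse hb' _ => exact absurd hb hb'
  | condFalse hb _ ih =>
    cases h₂ with
    | condTrue hb' _ => exact absurd hb' hb
    | condFalse _ g => obtain ⟨rfl, rfl⟩ := ih g; exact ⟨rfl, rfl⟩
  | loopStop hb =>
    cases h₂ with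
    | loopStop _ => exact ⟨rfl, rfl⟩
    | loopStep hb' _ _ => exact absurd hb' hb
  | loopStep hb _ _ ih ih' =>
    cases h₂ with
    | loopStop hb' => exact absurd hb hb'
    | loopStep _ g g' =>
      obtain ⟨rfl, rfl⟩ := ih g
      obtain ⟨rfl, rfl⟩ := ih' g'
      exact ⟨rfl, rfl⟩

end RealRAM

/-! The law of `f Q` is a probability measure `ν` on `ℝ^k`, so the claim is the uniform convergence
of empirical measures over orthants, with sample size `(k + log (1/δ)) / ε²` and no extra factor
`log (1/ε)`. A plain union bound over all traces would lose that factor; chaining removes it.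

Orthants cut out set systems of VC dimension at most `k` (`vcDim_orthantTrace_le`). By Sauer-Shelah
and random subsampling, a family of traces with pairwise distances above `η |V|` has at most
`(8/η)^(2k)` members (`card_separated_le`). Maximal separated families at the scales `4⁻ʲ` are
therefore nets whose log-cardinality grows only linearly in `j`. The increments between consecutive
nets are Rademacher sums of small variance, so Hoeffding's bound decays like `exp (-c ε² m (9/4)^j)`
and beats the net sizes at every scale (`card_exists_signedDiscrepancy_le`). Symmetrization with a
ghost sample transfers this to the empirical distribution
(`measure_exists_rat_dominatedFraction_le`), and one-sided continuity passes from rational to real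
thresholds.

The algorithm evaluates `f` on that many fresh samples. It obtains an integer comparable with `log
(1/δ)` by repeatedly doubling `δ`. -/

/-! ### Combinatorics of orthant traces: VC dimension and packing. -/

/-- `𝒜` consists of traces of orthants on the points `z`. -/
def IsOrthantTrace {V : Type*} {k : ℕ} [Fintype V] (z : V → Fin k → ℝ) (A : Finset V) : Prop :=
  ∃ v : Fin k → ℝ, ∀ i, i ∈ A ↔ z i ≤ v

/-- In a shattered `S`, choose a maximizer of each coordinate. An orthant containing these at most
`k` points contains all of `S`, so cutting out exactly the maximizers forces `S` to consist of them.
-/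
theorem vcDim_orthantTrace_le {V : Type*} {k : ℕ} [Fintype V] [DecidableEq V]
    (z : V → Fin k → ℝ) (𝒜 : Finset (Finset V)) (h𝒜 : ∀ A ∈ 𝒜, IsOrthantTrace z A) :
    𝒜.vcDim ≤ k := by
  classical
  refine Finset.sup_le fun S hS => ?_
  rw [Finset.mem_shatterer] at hS
  by_contra! hk
  have hne : S.Nonempty := Finset.card_pos.1 (by omega)
  choose g hg hmax using fun j : Fin k => S.exists_max_image (fun i => z i j) hne
  have hsub : Finset.univ.image g ⊆ S := by
    intro i hi
    obtain ⟨j, -, rfl⟩ := Finset.mem_image.1 hi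
    exact hg j
  obtain ⟨A, hA, hSA⟩ := hS hsub
  obtain ⟨v, hv⟩ := h𝒜 A hA
  have hSS : S ⊆ Finset.univ.image g := by
    intro i hi
    rw [← hSA, Finset.mem_inter, hv]
    refine ⟨hi, fun j => (hmax j i hi).trans ?_⟩
    have : g j ∈ S ∩ A := by rw [hSA]; exact Finset.mem_image_of_mem _ (Finset.mem_univ _)
    exact (hv _).1 (Finset.mem_inter.1 this).2 j
  have := (Finset.card_le_card hSS).trans Finset.card_image_le
  simp at this
  omega

/-- Binomial expansion restricted to `i ≤ k`, where `t ^ i ≥ t ^ k`. It puts the Sauer-Shelah sum in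
a form with a free parameter `t`. -/
theorem sum_choose_mul_pow_le (r k : ℕ) {t : ℝ} (h0 : 0 ≤ t) (h1 : t ≤ 1) :
    ((∑ i ∈ Finset.Iic k, r.choose i : ℕ) : ℝ) * t ^ k ≤ (1 + t) ^ r := by
  have h : (1 + t) ^ r = ∑ i ∈ Finset.range (r + 1), (r.choose i : ℝ) * t ^ i := by
    rw [add_comm, add_pow]
    exact Finset.sum_congr rfl fun i _ => by simp [mul_comm]
  have h' : ∑ i ∈ Finset.range (r + 1), (r.choose i : ℝ) * t ^ i
      = ∑ i ∈ Finset.range (r + 1) ∪ Finset.Iic k, (r.choose i : ℝ) * t ^ i := by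
    refine Finset.sum_subset Finset.subset_union_left fun i _ hi => ?_
    rw [Nat.choose_eq_zero_of_lt (by simpa using hi)]
    simp
  rw [h, h', Nat.cast_sum, Finset.sum_mul]
  refine le_trans (Finset.sum_le_sum fun i hi => ?_)
    (Finset.sum_le_sum_of_subset_of_nonneg Finset.subset_union_right fun i _ _ => by positivity)
  exact mul_le_mul_of_nonneg_left (pow_le_pow_of_le_one h0 h1 (by simpa using hi)) (by positivity)

/-- Some `r`-tuple of points distinguishes all members of a well separated family. -/
theorem exists_tuple_injOn_trace {V : Type*} [Fintype V] [DecidableEq V]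
    (P : Finset (Finset V)) {η : ℝ}
    (hsep : ∀ A ∈ P, ∀ B ∈ P, A ≠ B → η * Fintype.card V < (symmDiff A B).card)
    (hP : 2 ≤ P.card) (r : ℕ) (hr : (P.card : ℝ) ^ 2 ≤ Real.exp (η * r)) :
    ∃ y : Fin r → V, ∀ A ∈ P, ∀ B ∈ P, (∀ s, y s ∈ A ↔ y s ∈ B) → A = B := by
  classical
  by_contra! hcon
  have hV : 0 < Fintype.card V := by
    rw [Fintype.card_pos_iff]
    by_contra hV
    rw [not_nonempty_iff] at hV
    have := Finset.card_le_one_of_subsingleton P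
    omega
  -- Union bound: if no tuple works, every tuple misses the symmetric difference of some pair. Each
  -- pair accounts for at most a fraction `(1 - η)^r ≤ exp (-η r)` of the tuples, and there are
  -- fewer than `|P|²` pairs.
  have hcov : (Finset.univ : Finset (Fin r → V)) ⊆
      P.offDiag.biUnion fun q => Fintype.piFinset fun _ => (symmDiff q.1 q.2)ᶜ := by
    intro y _
    obtain ⟨A, hA, B, hB, hy, hAB⟩ := hcon y
    refine Finset.mem_biUnion.2 ⟨(A, B), by simp [hA, hB, hAB], ?_⟩
    simp only [Fintype.mem_piFinset, Finset.mem_compl, Finset.mem_symmDiff]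
    intro s
    have := hy s
    tauto
  have hbd : ∀ q ∈ P.offDiag,
      ((Fintype.piFinset fun _ : Fin r => (symmDiff q.1 q.2)ᶜ).card : ℝ)
        ≤ (Fintype.card V : ℝ) ^ r * Real.exp (-(η * r)) := by
    intro q hq
    rw [Finset.mem_offDiag] at hq
    have h := hsep _ hq.1 _ hq.2.1 hq.2.2
    rw [Fintype.card_piFinset_const, Nat.cast_pow]
    have hc : (((symmDiff q.1 q.2)ᶜ.card : ℕ) : ℝ) ≤ Fintype.card V * Real.exp (-η) := by
      have h2 := Finset.card_compl_add_card (symmDiff q.1 q.2)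
      have h3 : (((symmDiff q.1 q.2)ᶜ.card : ℕ) : ℝ) + (symmDiff q.1 q.2).card
        = Fintype.card V := by exact_mod_cast h2
      have := Real.one_sub_le_exp_neg η
      have : (Fintype.card V : ℝ) * (1 - η) ≤ Fintype.card V * Real.exp (-η) := by gcongr
      linarith
    calc _ ≤ (Fintype.card V * Real.exp (-η)) ^ r := by gcongr
      _ = _ := by rw [mul_pow, ← Real.exp_nat_mul]; ring_nf
  have hcard := Finset.card_le_card hcov
  have hcard2 := hcard.trans Finset.card_biUnion_le
  have : ((Fintype.card V) ^ r : ℝ) ≤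
      P.offDiag.card * ((Fintype.card V : ℝ) ^ r * Real.exp (-(η * r))) := by
    have h3 : ((Fintype.card V) ^ r : ℝ) = ((Finset.univ : Finset (Fin r → V)).card : ℝ) := by
      simp
    rw [h3]
    refine (Nat.cast_le.2 hcard2).trans ?_
    rw [Nat.cast_sum, ← nsmul_eq_mul]
    simpa using Finset.sum_le_card_nsmul _ _ _ hbd
  have hlt : (P.offDiag.card : ℝ) < (P.card : ℝ) ^ 2 := by
    rw [Finset.offDiag_card]
    have : P.card * P.card - P.card < P.card ^ 2 := by
      rw [sq]; apply Nat.sub_lt <;> nlinarith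
    exact_mod_cast this
  have hpos : (0 : ℝ) < (Fintype.card V : ℝ) ^ r := by positivity
  have h4 : (1 : ℝ) ≤ P.offDiag.card * Real.exp (-(η * r)) := by
    by_contra! h5
    nlinarith
  have h5 : (P.offDiag.card : ℝ) * Real.exp (-(η * r)) < 1 := by
    rw [Real.exp_neg, ← div_eq_mul_inv, div_lt_one (Real.exp_pos _)]
    exact hlt.trans_le hr
  linarith

/-- Packing bound for traces of orthants. -/
theorem card_separated_le {V : Type*} {k : ℕ} [Fintype V] [DecidableEq V]
    (hk : 0 < k) (z : V → Fin k → ℝ) (P : Finset (Finset V)) (hP : ∀ A ∈ P, IsOrthantTrace z A)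
    {η : ℝ} (h0 : 0 < η) (h1 : η ≤ 1)
    (hsep : ∀ A ∈ P, ∀ B ∈ P, A ≠ B → η * Fintype.card V < (symmDiff A B).card) :
    (P.card : ℝ) ≤ Real.exp (2 * k * Real.log (8 / η)) := by
  classical
  have hlog2 := Real.log_two_gt_d9
  have hlog : 2 ≤ Real.log (8 / η) := by
    have h8 : Real.log 8 = 3 * Real.log 2 := by
      rw [show (8 : ℝ) = 2 ^ 3 by norm_num, Real.log_pow]; norm_num
    have : Real.log 8 ≤ Real.log (8 / η) :=
      Real.log_le_log (by norm_num) (by rw [le_div_iff₀ h0]; linarith)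
    linarith
  have hk1 : (1 : ℝ) ≤ k := by exact_mod_cast hk
  rcases Nat.lt_or_ge P.card 2 with hc | hc
  · have : (P.card : ℝ) ≤ 1 := by exact_mod_cast Nat.lt_succ_iff.1 hc
    refine this.trans (Real.one_le_exp (by positivity))
  have hPpos : (0 : ℝ) < P.card := by
    have : (2 : ℝ) ≤ P.card := by exact_mod_cast hc
    linarith
  set l := Real.log P.card with hl
  have hl0 : 0 ≤ l := Real.log_natCast_nonneg _
  -- The least `r` with `|P|² ≤ exp (η r)`.
  set r := ⌈2 * l / η⌉₊ with hr
  have hr1 : 2 * l ≤ η * r := by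
    have := Nat.le_ceil (2 * l / η)
    rw [div_le_iff₀ h0] at this
    linarith
  have hr2 : η * r ≤ 2 * l + η := by
    have := (Nat.ceil_lt_add_one (a := 2 * l / η) (by positivity)).le
    have h2 : η * (⌈2 * l / η⌉₊ : ℝ) ≤ η * (2 * l / η + 1) := by gcongr
    have h3 : η * (2 * l / η + 1) = 2 * l + η := by field_simp
    linarith
  obtain ⟨y, hy⟩ := exists_tuple_injOn_trace P hsep hc r (by
    rw [← Real.exp_log hPpos, ← Real.exp_nat_mul]
    exact Real.exp_le_exp.2 (by push_cast; linarith))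
  -- The traces of `P` on the tuple `y` are as many as `P` and are again orthant traces, now on only
  -- `r` points, so Sauer-Shelah bounds `|P|` in terms of `r`.
  set Q := P.image fun A => Finset.univ.filter fun s => y s ∈ A with hQ
  have hcardQ : Q.card = P.card := by
    refine Finset.card_image_of_injOn fun A hA B hB hAB => hy A hA B hB fun s => ?_
    have := congrArg (s ∈ ·) hAB
    simpa using this
  have hvc : Q.vcDim ≤ k := by
    refine vcDim_orthantTrace_le (z ∘ y) Q fun B hB => ?_
    obtain ⟨A, hA, rfl⟩ := Finset.mem_image.1 hB
    obtain ⟨v, hv⟩ := hP A hA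
    exact ⟨v, fun i => by simp [hv]⟩
  have hS := (Finset.card_le_card_shatterer Q).trans Finset.card_shatterer_le_sum_vcDim
  rw [hcardQ, Fintype.card_fin] at hS
  have hS2 : P.card ≤ ∑ i ∈ Finset.Iic k, r.choose i :=
    hS.trans (Finset.sum_le_sum_of_subset (Finset.Iic_subset_Iic.2 hvc))
  -- With `t = η / 8`, the exponent `η r / 8 ≤ (2 l + η) / 8` absorbs only a quarter of `l = log
  -- |P|`, so the inequality can be solved for `l`.
  have hS3 := sum_choose_mul_pow_le r k (t := η / 8) (by positivity) (by linarith)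
  have hS4 : (P.card : ℝ) * (η / 8) ^ k ≤ Real.exp (η / 8 * r) := by
    calc (P.card : ℝ) * (η / 8) ^ k ≤ _ * (η / 8) ^ k := by
          gcongr
      _ ≤ (1 + η / 8) ^ r := hS3
      _ ≤ (Real.exp (η / 8)) ^ r := by
          gcongr; rw [add_comm]; exact Real.add_one_le_exp _
      _ = _ := by rw [← Real.exp_nat_mul, mul_comm]
  have hS5 := Real.log_le_log (by positivity) hS4
  rw [Real.log_exp, Real.log_mul (by positivity) (by positivity), Real.log_pow,
    show η / 8 = (8 / η)⁻¹ by rw [inv_div], Real.log_inv, inv_div] at hS5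
  rw [← Real.exp_log hPpos]
  refine Real.exp_le_exp.2 ?_
  nlinarith

/-- Greedy selection: a set is kept only if it is far from all those already kept, so a discarded
set is close to a kept one. -/
theorem exists_maximal_separated {V : Type*} [DecidableEq V] (𝒜 : Finset (Finset V)) {c : ℝ}
    (hc : 0 ≤ c) : ∃ P ⊆ 𝒜, (∀ A ∈ P, ∀ B ∈ P, A ≠ B → c < (symmDiff A B).card) ∧
      ∀ S ∈ 𝒜, ∃ A ∈ P, ((symmDiff S A).card : ℝ) ≤ c := by
  classical
  induction 𝒜 using Finset.induction_on with
  | empty => exact ⟨∅, by simp⟩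
  | insert S 𝒜 _ ih =>
    obtain ⟨P, hP, hsep, hcov⟩ := ih
    by_cases h : ∃ A ∈ P, ((symmDiff S A).card : ℝ) ≤ c
    · refine ⟨P, hP.trans (Finset.subset_insert _ _), hsep, fun B hB => ?_⟩
      rcases Finset.mem_insert.1 hB with rfl | hB
      · exact h
      · exact hcov B hB
    · push Not at h
      refine ⟨insert S P, Finset.insert_subset_insert _ hP, ?_, ?_⟩
      · intro A hA B hB hAB
        rcases Finset.mem_insert.1 hA with hA' | hA' <;>
          rcases Finset.mem_insert.1 hB with hB' | hB'
        · exact absurd (hA'.trans hB'.symm) hAB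
        · exact hA' ▸ h B hB'
        · rw [symmDiff_comm]; exact hB' ▸ h A hA'
        · exact hsep A hA' B hB' hAB
      · intro B hB
        rcases Finset.mem_insert.1 hB with rfl | hB
        · exact ⟨B, by simp, by simpa using hc⟩
        · obtain ⟨A, hA, h⟩ := hcov B hB
          exact ⟨A, Finset.mem_insert_of_mem hA, h⟩

/-! ### Rademacher sums and chaining. -/

/-- Hoeffding's inequality for Rademacher sums, in counting form. -/
theorem card_rademacher_le {ι : Type*} [Fintype ι] [DecidableEq ι] (a : ι → ℝ) {t s : ℝ}
    (ht : 0 ≤ t) (hs : 0 < s) (ha : ∑ i, a i ^ 2 ≤ s) :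
    ((Finset.univ.filter fun σ : ι → Bool =>
      t ≤ ∑ i, (if σ i then 1 else -1) * a i).card : ℝ)
      ≤ 2 ^ Fintype.card ι * Real.exp (-(t ^ 2 / (2 * s))) := by
  -- The minimizer of the Chernoff exponent `l² s / 2 - l t`.
  set l := t / s with hl
  have hl0 : 0 ≤ l := by positivity
  have hmgf : ∑ σ : ι → Bool, Real.exp (l * ∑ i, (if σ i then 1 else -1) * a i)
      ≤ 2 ^ Fintype.card ι * Real.exp (l ^ 2 * s / 2) := by
    have h1 : ∀ σ : ι → Bool, Real.exp (l * ∑ i, (if σ i then 1 else -1) * a i)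
        = ∏ i, Real.exp (l * ((if σ i then 1 else -1) * a i)) := fun σ => by
      rw [Finset.mul_sum, Real.exp_sum]
    have h2 := Fintype.prod_sum (fun (i : ι) (b : Bool) =>
      Real.exp (l * ((if b then 1 else -1) * a i)))
    simp_rw [h1]
    rw [← h2]
    have h3 : ∀ i, ∑ b : Bool, Real.exp (l * ((if b then 1 else -1) * a i))
        ≤ 2 * Real.exp ((l * a i) ^ 2 / 2) := fun i => by
      have := Real.cosh_le_exp_half_sq (l * a i)
      rw [Real.cosh_eq] at this
      simp only [Fintype.sum_bool, if_true, Bool.false_eq_true, if_false, one_mul, neg_mul, mul_neg]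
      linarith
    refine (Finset.prod_le_prod (fun i _ => Finset.sum_nonneg fun b _ => (Real.exp_pos _).le)
      fun i _ => h3 i).trans ?_
    rw [Finset.prod_mul_distrib, ← Real.exp_sum, Finset.prod_const, Finset.card_univ]
    gcongr
    rw [← Finset.sum_div]
    gcongr
    simp_rw [mul_pow]
    rw [← Finset.mul_sum]
    gcongr
  have hmk : ((Finset.univ.filter fun σ : ι → Bool =>
      t ≤ ∑ i, (if σ i then 1 else -1) * a i).card : ℝ) * Real.exp (l * t)
      ≤ ∑ σ : ι → Bool, Real.exp (l * ∑ i, (if σ i then 1 else -1) * a i) := by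
    rw [← nsmul_eq_mul]
    refine (Finset.card_nsmul_le_sum _ _ _ fun σ hσ => ?_).trans
      (Finset.sum_le_sum_of_subset_of_nonneg (Finset.filter_subset _ _)
        fun _ _ _ => (Real.exp_pos _).le)
    have := (Finset.mem_filter.1 hσ).2
    gcongr
  have h := hmk.trans hmgf
  rw [← le_div_iff₀ (Real.exp_pos _), mul_div_assoc, ← Real.exp_sub] at h
  refine h.trans_eq ?_
  congr 2
  rw [hl]
  field_simp
  ring

theorem card_abs_rademacher_le {ι : Type*} [Fintype ι] [DecidableEq ι] (a : ι → ℝ) {t s : ℝ}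
    (ht : 0 ≤ t) (hs : 0 < s) (ha : ∑ i, a i ^ 2 ≤ s) :
    ((Finset.univ.filter fun σ : ι → Bool =>
      t ≤ |∑ i, (if σ i then 1 else -1) * a i|).card : ℝ)
      ≤ 2 ^ Fintype.card ι * (2 * Real.exp (-(t ^ 2 / (2 * s)))) := by
  have h1 := card_rademacher_le a ht hs ha
  have h2 := card_rademacher_le (fun i => -a i) ht hs (by simpa using ha)
  simp only [mul_neg, Finset.sum_neg_distrib] at h2
  have : (Finset.univ.filter fun σ : ι → Bool => t ≤ |∑ i, (if σ i then 1 else -1) * a i|)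
      = (Finset.univ.filter fun σ : ι → Bool => t ≤ ∑ i, (if σ i then 1 else -1) * a i) ∪
        (Finset.univ.filter fun σ : ι → Bool => t ≤ -∑ i, (if σ i then 1 else -1) * a i) := by
    ext σ
    simp [le_abs]
  rw [this]
  have h3 := Nat.cast_le (α := ℝ).2 (Finset.card_union_le
    (Finset.univ.filter fun σ : ι → Bool => t ≤ ∑ i, (if σ i then 1 else -1) * a i)
    (Finset.univ.filter fun σ : ι → Bool => t ≤ -∑ i, (if σ i then 1 else -1) * a i))
  push_cast at h3
  linarith

/-- The signed difference between the two halves of `S`. -/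
def signedDiscrepancy {ι : Type*} [Fintype ι] [DecidableEq ι] (σ : ι → Bool)
    (S : Finset (ι ⊕ ι)) : ℝ :=
  ∑ i, (if σ i then 1 else -1) *
    ((if Sum.inl i ∈ S then (1 : ℝ) else 0) - if Sum.inr i ∈ S then 1 else 0)

/-- The increment is a Rademacher sum with coefficients `u (inl i) - u (inr i)`, where `u` is the
difference of the indicators. Since `(a - b)² ≤ 2a² + 2b²`, their squares sum to at most `2 |A ∆
B|`. -/
theorem card_signedDiscrepancy_sub_le {ι : Type*} [Fintype ι] [DecidableEq ι]
    (A B : Finset (ι ⊕ ι)) {t c : ℝ} (ht : 0 ≤ t) (hc : 0 < c)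
    (hAB : ((symmDiff A B).card : ℝ) ≤ c) :
    ((Finset.univ.filter fun σ : ι → Bool =>
      t ≤ |signedDiscrepancy σ B - signedDiscrepancy σ A|).card : ℝ)
      ≤ 2 ^ Fintype.card ι * (2 * Real.exp (-(t ^ 2 / (4 * c)))) := by
  set u : ι ⊕ ι → ℝ := fun x => (if x ∈ B then 1 else 0) - if x ∈ A then 1 else 0 with hu
  have husq : ∀ x, u x ^ 2 = if x ∈ symmDiff A B then 1 else 0 := fun x => by
    by_cases hA : x ∈ A <;> by_cases hB : x ∈ B <;> simp [hu, hA, hB, Finset.mem_symmDiff]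
  have hsum : ∑ i, u (.inl i) ^ 2 + ∑ i, u (.inr i) ^ 2 = (symmDiff A B).card := by
    rw [← Fintype.sum_sum_type (fun x => u x ^ 2)]
    simp_rw [husq]
    simp
  have h := card_abs_rademacher_le (fun i => u (.inl i) - u (.inr i)) ht
    (s := 2 * c) (by positivity) (by
      calc ∑ i, (u (.inl i) - u (.inr i)) ^ 2
          ≤ ∑ i, (2 * u (.inl i) ^ 2 + 2 * u (.inr i) ^ 2) :=
            Finset.sum_le_sum fun i _ => by nlinarith [sq_nonneg (u (.inl i) + u (.inr i))]
        _ = 2 * (symmDiff A B).card := by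
            rw [Finset.sum_add_distrib, ← Finset.mul_sum, ← Finset.mul_sum, ← hsum]; ring
        _ ≤ 2 * c := by linarith)
  have he : ∀ σ : ι → Bool, signedDiscrepancy σ B - signedDiscrepancy σ A
      = ∑ i, (if σ i then 1 else -1) * (u (.inl i) - u (.inr i)) := fun σ => by
    rw [signedDiscrepancy, signedDiscrepancy, ← Finset.sum_sub_distrib]
    exact Finset.sum_congr rfl fun i _ => by simp only [hu]; ring
  simp_rw [he]
  convert h using 5
  ring

/-- Chaining along nets `P j` at scale `4⁻ʲ`. -/
theorem abs_signedDiscrepancy_le_sum {ι : Type*} [Fintype ι] [DecidableEq ι] (σ : ι → Bool)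
    (𝒜 : Finset (Finset (ι ⊕ ι))) (P : ℕ → Finset (Finset (ι ⊕ ι))) (hP0 : P 0 = {∅}) {N : ℝ}
    (hcov : ∀ j, ∀ S ∈ 𝒜, ∃ A ∈ P j, ((symmDiff S A).card : ℝ) ≤ (1 / 4) ^ j * N)
    {t : ℕ → ℝ} {J : ℕ}
    (hσ : ∀ j < J, ∀ A ∈ P j, ∀ B ∈ P (j + 1),
      ((symmDiff A B).card : ℝ) ≤ 5 / 4 * ((1 / 4) ^ j * N) →
        |signedDiscrepancy σ B - signedDiscrepancy σ A| ≤ t j)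
    (hJ : (1 / 4) ^ J * N < 1) {S : Finset (ι ⊕ ι)} (hS : S ∈ 𝒜) :
    |signedDiscrepancy σ S| ≤ ∑ j ∈ Finset.range J, t j := by
  choose A hA hAS using fun j => hcov j S hS
  have h0 : A 0 = ∅ := by simpa [hP0] using hA 0
  -- At a scale below one element, the net approximation is exact, so the chain ends at `S`.
  have hJS : A J = S := by
    have : (symmDiff S (A J)).card = 0 := by
      have := (hAS J).trans_lt hJ
      exact_mod_cast Nat.lt_one_iff.1 (by exact_mod_cast this)
    rw [Finset.card_eq_zero] at this
    exact (symmDiff_eq_bot.1 this).symm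
  have htel : signedDiscrepancy σ S = ∑ j ∈ Finset.range J,
      (signedDiscrepancy σ (A (j + 1)) - signedDiscrepancy σ (A j)) := by
    rw [Finset.sum_range_sub (fun j => signedDiscrepancy σ (A j)), h0, hJS]
    simp [signedDiscrepancy]
  rw [htel]
  refine (Finset.abs_sum_le_sum_abs _ _).trans (Finset.sum_le_sum fun j hj => ?_)
  refine hσ j (Finset.mem_range.1 hj) _ (hA j) _ (hA (j + 1)) ?_
  -- The triangle inequality through `S` gives `4⁻ʲ + 4⁻⁽ʲ⁺¹⁾ = (5/4) 4⁻ʲ`.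
  have h1 : (symmDiff (A j) (A (j + 1))).card
      ≤ (symmDiff S (A j)).card + (symmDiff S (A (j + 1))).card := by
    rw [symmDiff_comm S (A j)]
    exact (Finset.card_le_card (symmDiff_triangle (A j) S (A (j + 1)))).trans
      (Finset.card_union_le _ _)
  have h2 : ((symmDiff (A j) (A (j + 1))).card : ℝ)
      ≤ (symmDiff S (A j)).card + (symmDiff S (A (j + 1))).card := by exact_mod_cast h1
  have h3 := hAS j
  have h4 := hAS (j + 1)
  rw [pow_succ] at h4
  linarith

/-- The packing bound at `η = 4⁻ʲ` has exponent `2k (3 + 2j) log 2 ≤ 5k (j + 1)`. Level `0` is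
replaced by `{∅}`, which trivially covers at scale `|V|` and starts the chain at discrepancy zero.
-/
theorem exists_nets {V : Type*} {k : ℕ} [Fintype V] [DecidableEq V] (hk : 0 < k)
    (z : V → Fin k → ℝ) (𝒜 : Finset (Finset V)) (h𝒜 : ∀ A ∈ 𝒜, IsOrthantTrace z A) :
    ∃ P : ℕ → Finset (Finset V), P 0 = {∅} ∧
      (∀ j, ((P j).card : ℝ) ≤ Real.exp (5 * k * (j + 1))) ∧
      ∀ j, ∀ S ∈ 𝒜, ∃ A ∈ P j, ((symmDiff S A).card : ℝ) ≤ (1 / 4) ^ j * Fintype.card V := by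
  have h := fun j : ℕ => exists_maximal_separated 𝒜 (c := (1 / 4) ^ j * Fintype.card V)
    (by positivity)
  choose P hP𝒜 hsep hcov using h
  refine ⟨fun j => if j = 0 then {∅} else P j, by simp, fun j => ?_, fun j S hS => ?_⟩
  · rcases Nat.eq_zero_or_pos j with rfl | hj
    · simp
    · simp only [hj.ne', if_false]
      refine (card_separated_le hk z (P j) (fun A hA => h𝒜 A (hP𝒜 j hA)) (η := (1 / 4) ^ j)
        (by positivity) (pow_le_one₀ (by norm_num) (by norm_num)) (hsep j)).trans ?_
      refine Real.exp_le_exp.2 ?_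
      have h2 := Real.log_two_lt_d9
      have h8 : Real.log (8 / (1 / 4) ^ j) = (3 + 2 * j) * Real.log 2 := by
        rw [show (8 : ℝ) / (1 / 4) ^ j = 2 ^ (3 + 2 * j) by
          rw [pow_add, pow_mul, one_div, inv_pow]; norm_num, Real.log_pow]
        push_cast; ring
      rw [h8]
      have h3 : (3 + 2 * (j : ℝ)) * Real.log 2 ≤ (3 + 2 * j) * 0.7 := by
        gcongr; linarith
      have h4 : (3 + 2 * (j : ℝ)) * Real.log 2 ≤ 5 / 2 * (j + 1) := by
        have : (0 : ℝ) ≤ j := j.cast_nonneg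
        linarith
      calc 2 * (k : ℝ) * ((3 + 2 * j) * Real.log 2) ≤ 2 * k * (5 / 2 * (j + 1)) := by gcongr
        _ = _ := by ring
  · rcases Nat.eq_zero_or_pos j with rfl | hj
    · exact ⟨∅, by simp, by
        rw [← Finset.bot_eq_empty, symmDiff_bot]
        simpa using Finset.card_le_univ S⟩
    · simpa only [hj.ne', if_false] using hcov j S hS

/-- Since `(9/4)^j ≥ j + 1` and `11520 / 640 = 18`, the Hoeffding exponent is at least `18 (k + Λ)(j
+ 1)`. The two net sizes use at most `15 k (j + 1)` of it; the rest pays for `δ` and for summability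
in `j`. -/
theorem chaining_exponent_le {k j : ℕ} {M Λ : ℝ} (hk : 1 ≤ k) (hΛ : 0 ≤ Λ)
    (hM : 11520 * (k + Λ) ≤ M) :
    5 * k * ((j : ℝ) + 1) + 5 * k * ((j + 1 : ℕ) + 1) - M / 640 * (9 / 4) ^ j
      ≤ -Λ - 3 * (j + 1) := by
  have hk1 : (1 : ℝ) ≤ k := by exact_mod_cast hk
  have hj : (0 : ℝ) ≤ j := j.cast_nonneg
  have hb : (j : ℝ) + 1 ≤ (9 / 4) ^ j := by
    have := one_add_mul_le_pow (a := (5 / 4 : ℝ)) (by norm_num) j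
    norm_num at this
    linarith
  have h1 : 18 * (k + Λ) * (j + 1) ≤ M / 640 * (9 / 4) ^ j :=
    mul_le_mul (by linarith) hb (by positivity) (by linarith)
  push_cast
  nlinarith [mul_nonneg hΛ hj, mul_nonneg (sub_nonneg.2 hk1) hj]

theorem sum_range_three_fourths_le (J : ℕ) : ∑ j ∈ Finset.range J, (3 / 4 : ℝ) ^ j < 4 := by
  have h := geom_sum_eq (x := (3 / 4 : ℝ)) (by norm_num) J
  rw [h]
  have : (0 : ℝ) < (3 / 4) ^ J := by positivity
  rw [div_lt_iff_of_neg (by norm_num)]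
  linarith

theorem sum_range_exp_le (J : ℕ) :
    ∑ j ∈ Finset.range J, 2 * Real.exp (-3 * ((j : ℝ) + 1)) ≤ 1 / 2 := by
  have h8 : Real.exp (-3) ≤ 1 / 8 := by
    rw [Real.exp_neg, one_div]
    have h2 : (2 : ℝ) ≤ Real.exp 1 := by have := Real.add_one_le_exp (1 : ℝ); linarith
    have h3 : Real.exp 3 = Real.exp 1 ^ 3 := by rw [← Real.exp_nat_mul]; norm_num
    gcongr
    rw [h3]
    calc (8 : ℝ) = 2 ^ 3 := by norm_num
      _ ≤ _ := by gcongr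
  have h : ∑ j ∈ Finset.range J, 2 * Real.exp (-3 * ((j : ℝ) + 1))
      ≤ ∑ j ∈ Finset.range J, 1 / 4 * (1 / 8 : ℝ) ^ j := by
    refine Finset.sum_le_sum fun j _ => ?_
    have : Real.exp (-3 * ((j : ℝ) + 1)) = Real.exp (-3) ^ (j + 1) := by
      rw [← Real.exp_nat_mul]; push_cast; ring_nf
    rw [this]
    have h2 : Real.exp (-3) ^ (j + 1) ≤ (1 / 8) ^ (j + 1) := by gcongr
    rw [pow_succ (1 / 8 : ℝ)] at h2
    linarith
  refine h.trans ?_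
  rw [← Finset.mul_sum, geom_sum_eq (by norm_num)]
  have : (0 : ℝ) < (1 / 8) ^ J := by positivity
  rw [mul_div_assoc', div_le_iff_of_neg (by norm_num)]
  linarith

/-- For random signs, all traces of orthants have small signed discrepancy with high
probability. -/
theorem card_exists_signedDiscrepancy_le {ι : Type*} [Fintype ι] [DecidableEq ι] {k : ℕ}
    (hk : 0 < k) {ε δ : ℝ} (hε : 0 < ε) (hδ : 0 < δ) (hδ1 : δ < 1)
    (hm : 11520 * (k + Real.log (1 / δ)) ≤ ε ^ 2 * Fintype.card ι) (z : ι ⊕ ι → Fin k → ℝ)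
    (𝒜 : Finset (Finset (ι ⊕ ι))) (h𝒜 : ∀ A ∈ 𝒜, IsOrthantTrace z A) :
    ((Finset.univ.filter fun σ : ι → Bool =>
      ∃ S ∈ 𝒜, ε * Fintype.card ι / 2 ≤ |signedDiscrepancy σ S|).card : ℝ)
      ≤ 2 ^ Fintype.card ι * (δ / 2) := by
  classical
  set m : ℝ := (Fintype.card ι : ℝ) with hmdef
  have hk1 : (1 : ℝ) ≤ k := by exact_mod_cast hk
  have hΛ : 0 ≤ Real.log (1 / δ) := Real.log_nonneg (by rw [le_div_iff₀ hδ]; linarith)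
  have hmpos : 0 < m := by
    by_contra! h
    have : ε ^ 2 * m ≤ 0 := mul_nonpos_of_nonneg_of_nonpos (by positivity) h
    linarith
  have hN : (Fintype.card (ι ⊕ ι) : ℝ) = 2 * m := by
    rw [Fintype.card_sum]; push_cast; ring
  obtain ⟨P, hP0, hPcard, hcov⟩ := exists_nets hk z 𝒜 h𝒜
  rw [hN] at hcov
  obtain ⟨J, hJ⟩ : ∃ J : ℕ, (1 / 4 : ℝ) ^ J * (2 * m) < 1 := by
    obtain ⟨J, hJ⟩ := exists_pow_lt_of_lt_one (x := 1 / (2 * m)) (y := (1 / 4 : ℝ))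
      (by positivity) (by norm_num)
    exact ⟨J, by rwa [lt_div_iff₀ (by positivity)] at hJ⟩
  -- The increments allowed sum to less than `ε m / 2` because `∑ (3/4)^j < 4`. The ratio `3/4`
  -- exceeds `1/2`, the square root of the ratio of the scales, so the Hoeffding exponents grow, by
  -- the factor `(9/16) / (1/4) = 9/4` per level.
  set t : ℕ → ℝ := fun j => ε * m / 8 * (3 / 4) ^ j with ht
  set E : ℕ → Finset (ι → Bool) := fun j => ((P j ×ˢ P (j + 1)).filter fun q =>
      ((symmDiff q.1 q.2).card : ℝ) ≤ 5 / 4 * ((1 / 4) ^ j * (2 * m))).biUnion fun q =>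
      Finset.univ.filter fun σ => t j ≤ |signedDiscrepancy σ q.2 - signedDiscrepancy σ q.1| with hE
  -- A large discrepancy of some trace forces some link of its chain to be too long.
  have hsub : (Finset.univ.filter fun σ : ι → Bool =>
      ∃ S ∈ 𝒜, ε * m / 2 ≤ |signedDiscrepancy σ S|) ⊆ (Finset.range J).biUnion E := by
    intro σ hσ
    obtain ⟨S, hS, hSσ⟩ := (Finset.mem_filter.1 hσ).2
    by_contra hcon
    have hgood := abs_signedDiscrepancy_le_sum σ 𝒜 P hP0 hcov (t := t) (J := J) (by
      intro j hj A hA B hB hAB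
      by_contra! hlt
      refine hcon (Finset.mem_biUnion.2 ⟨j, Finset.mem_range.2 hj, ?_⟩)
      exact Finset.mem_biUnion.2 ⟨(A, B), Finset.mem_filter.2 ⟨Finset.mk_mem_product hA hB, hAB⟩,
        Finset.mem_filter.2 ⟨Finset.mem_univ _, hlt.le⟩⟩) hJ hS
    rw [ht, ← Finset.mul_sum] at hgood
    have h4 := sum_range_three_fourths_le J
    have : ε * m / 8 * ∑ j ∈ Finset.range J, (3 / 4 : ℝ) ^ j < ε * m / 8 * 4 := by gcongr
    linarith
  have hEcard : ∀ j, ((E j).card : ℝ)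
      ≤ 2 ^ Fintype.card ι * (δ * (2 * Real.exp (-3 * ((j : ℝ) + 1)))) := by
    intro j
    have hq : ∀ q ∈ (P j ×ˢ P (j + 1)).filter fun q =>
        ((symmDiff q.1 q.2).card : ℝ) ≤ 5 / 4 * ((1 / 4) ^ j * (2 * m)),
        (((Finset.univ.filter fun σ =>
          t j ≤ |signedDiscrepancy σ q.2 - signedDiscrepancy σ q.1|).card : ℕ) : ℝ)
          ≤ 2 ^ Fintype.card ι * (2 * Real.exp (-(ε ^ 2 * m / 640 * (9 / 4) ^ j))) := by
      intro q hq
      have h := card_signedDiscrepancy_sub_le q.1 q.2 (t := t j) (by positivity) (by positivity)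
        (Finset.mem_filter.1 hq).2
      refine h.trans_eq ?_
      have : t j ^ 2 / (4 * (5 / 4 * ((1 / 4) ^ j * (2 * m)))) = ε ^ 2 * m / 640 * (9 / 4) ^ j := by
        have h94 : (9 / 4 : ℝ) ^ j * (1 / 4) ^ j = ((3 / 4) ^ j) ^ 2 := by
          rw [← mul_pow, ← pow_mul, mul_comm j 2, pow_mul]; norm_num
        rw [div_eq_iff (by positivity), ht]
        simp only
        rw [mul_pow, ← h94]
        ring
      rw [this]
    have hPP : ((((P j ×ˢ P (j + 1)).filter fun q =>
        ((symmDiff q.1 q.2).card : ℝ) ≤ 5 / 4 * ((1 / 4) ^ j * (2 * m))).card : ℕ) : ℝ)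
        ≤ Real.exp (5 * k * ((j : ℝ) + 1) + 5 * k * ((j + 1 : ℕ) + 1)) := by
      rw [Real.exp_add]
      calc _ ≤ (((P j ×ˢ P (j + 1)).card : ℕ) : ℝ) :=
            Nat.cast_le.2 (Finset.card_filter_le _ _)
        _ = (P j).card * (P (j + 1)).card := by rw [Finset.card_product]; push_cast; ring
        _ ≤ _ := mul_le_mul (hPcard j) (hPcard (j + 1)) (by positivity) (by positivity)
    have hEj := (Nat.cast_le (α := ℝ)).2 (Finset.card_biUnion_le (s := (P j ×ˢ P (j + 1)).filter
      fun q => ((symmDiff q.1 q.2).card : ℝ) ≤ 5 / 4 * ((1 / 4) ^ j * (2 * m))) (t := fun q =>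
      Finset.univ.filter fun σ => t j ≤ |signedDiscrepancy σ q.2 - signedDiscrepancy σ q.1|))
    rw [Nat.cast_sum] at hEj
    have hEj2 := hEj.trans ((Finset.sum_le_card_nsmul _ _ _ hq).trans_eq (nsmul_eq_mul _ _))
    calc ((E j).card : ℝ) ≤ Real.exp (5 * k * ((j : ℝ) + 1) + 5 * k * ((j + 1 : ℕ) + 1)) *
          (2 ^ Fintype.card ι * (2 * Real.exp (-(ε ^ 2 * m / 640 * (9 / 4) ^ j)))) :=
          hEj2.trans (mul_le_mul_of_nonneg_right hPP (by positivity))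
      _ = 2 ^ Fintype.card ι * (2 * Real.exp (5 * k * ((j : ℝ) + 1) + 5 * k * ((j + 1 : ℕ) + 1)
            - ε ^ 2 * m / 640 * (9 / 4) ^ j)) := by
          rw [sub_eq_add_neg, Real.exp_add _ (-_)]; ring
      _ ≤ 2 ^ Fintype.card ι * (2 * Real.exp (-Real.log (1 / δ) - 3 * (j + 1))) := by
          gcongr 2 ^ Fintype.card ι * (2 * Real.exp ?_)
          exact chaining_exponent_le hk hΛ hm
      _ = _ := by
          rw [sub_eq_add_neg, Real.exp_add, one_div, Real.log_inv, neg_neg, Real.exp_log hδ]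
          ring_nf
  calc _ ≤ ((((Finset.range J).biUnion E).card : ℕ) : ℝ) :=
        Nat.cast_le.2 (Finset.card_le_card hsub)
    _ ≤ ∑ j ∈ Finset.range J, ((E j).card : ℝ) := by
        rw [← Nat.cast_sum]; exact Nat.cast_le.2 Finset.card_biUnion_le
    _ ≤ ∑ j ∈ Finset.range J,
          2 ^ Fintype.card ι * (δ * (2 * Real.exp (-3 * ((j : ℝ) + 1)))) :=
        Finset.sum_le_sum fun j _ => hEcard j
    _ = 2 ^ Fintype.card ι * (δ * ∑ j ∈ Finset.range J, 2 * Real.exp (-3 * ((j : ℝ) + 1))) := by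
        rw [Finset.mul_sum, Finset.mul_sum]
    _ ≤ 2 ^ Fintype.card ι * (δ * (1 / 2)) := by
        gcongr; exact sum_range_exp_le J
    _ = _ := by ring

/-! ### Symmetrization with a ghost sample. -/

open scoped Classical in
theorem dominatedFraction_eq_sum {m k : ℕ} (x : Fin m → Fin k → ℝ) (v : Fin k → ℝ) :
    dominatedFraction x v = (∑ i, if x i ≤ v then (1 : ℝ) else 0) / m := by
  rw [dominatedFraction, Nat.card_eq_fintype_card, Fintype.card_subtype]
  simp

theorem dominatedFraction_mono {m k : ℕ} (x : Fin m → Fin k → ℝ) :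
    Monotone (dominatedFraction x) := by
  intro v w hvw
  rw [dominatedFraction_eq_sum, dominatedFraction_eq_sum]
  gcongr with i _
  split_ifs with h1 h2
  · exact le_rfl
  · exact absurd (h1.trans hvw) h2
  · exact zero_le_one
  · exact le_rfl

open scoped Classical in
theorem measurable_indicator_le {α : Type*} [MeasurableSpace α] {k : ℕ} {g : α → Fin k → ℝ}
    (hg : Measurable g) (v : Fin k → ℝ) :
    Measurable fun x => if g x ≤ v then (1 : ℝ) else 0 :=
  Measurable.ite (hg measurableSet_Iic) measurable_const measurable_const

open scoped Classical in
/-- Chebyshev's inequality for the fraction of sample points dominated by a fixed `v`. -/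
theorem half_le_measure_dominatedFraction {m k : ℕ} {ε : ℝ} (hε : 0 < ε) (hm : 2 ≤ ε ^ 2 * m)
    (ν : Measure (Fin k → ℝ)) [IsProbabilityMeasure ν] (v : Fin k → ℝ) :
    2⁻¹ ≤ (Measure.pi fun _ : Fin m => ν)
      {x | |dominatedFraction x v - ν.real (Set.Iic v)| ≤ ε / 2} := by
  have hmpos : (0 : ℝ) < m := by
    by_contra! h
    have : ε ^ 2 * m ≤ 0 := mul_nonpos_of_nonneg_of_nonpos (by positivity) h
    linarith
  set X : Fin m → (Fin k → ℝ) → ℝ := fun _ y => if y ≤ v then 1 else 0 with hX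
  have hXm : ∀ i, Measurable (X i) := fun i => measurable_indicator_le measurable_id v
  have hXb : ∀ i y, X i y ∈ Set.Icc (0 : ℝ) 1 := fun i y => by
    simp only [hX]; split_ifs <;> simp
  have hXL : ∀ i, MemLp (X i) 2 ν := fun i =>
    MemLp.of_bound (hXm i).aestronglyMeasurable 1 (Filter.Eventually.of_forall fun y => by
      rw [Real.norm_eq_abs, abs_of_nonneg (hXb i y).1]; exact (hXb i y).2)
  set S : (Fin m → Fin k → ℝ) → ℝ := ∑ i, fun x => X i (x i) with hS
  have hSapp : ∀ x, S x = ∑ i, if x i ≤ v then (1 : ℝ) else 0 := fun x => by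
    simp [hS, hX, Finset.sum_apply]
  have hSL : MemLp S 2 (Measure.pi fun _ : Fin m => ν) :=
    memLp_finsetSum' _ fun i _ => (hXL i).comp_measurePreserving
      (measurePreserving_eval (fun _ : Fin m => ν) i)
  have hvar : ProbabilityTheory.variance S (Measure.pi fun _ : Fin m => ν) ≤ m / 4 := by
    rw [hS, ProbabilityTheory.variance_sum_pi hXL]
    calc _ ≤ ∑ _i : Fin m, ((1 - 0) / 2 : ℝ) ^ 2 := Finset.sum_le_sum fun i _ =>
          ProbabilityTheory.variance_le_sq_of_bounded
            (Filter.Eventually.of_forall (hXb i)) (hXm i).aemeasurable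
      _ = _ := by simp; ring
  have hmean : ∫ x, S x ∂(Measure.pi fun _ : Fin m => ν) = m * ν.real (Set.Iic v) := by
    have h1 : ∀ i : Fin m, ∫ x, X i (x i) ∂(Measure.pi fun _ : Fin m => ν)
        = ν.real (Set.Iic v) := fun i => by
      rw [integral_comp_eval (μ := fun _ : Fin m => ν) (hXm i).aestronglyMeasurable]
      have : X i = (Set.Iic v : Set (Fin k → ℝ)).indicator 1 := by
        ext y; simp [hX, Set.indicator_apply]
      rw [this, integral_indicator_one measurableSet_Iic]
    simp only [hS, Finset.sum_apply]
    rw [integral_finsetSum]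
    · simp [h1]
    · intro i _
      exact ((hXL i).comp_measurePreserving
        (measurePreserving_eval (fun _ : Fin m => ν) i)).integrable (by norm_num)
  -- Variance at most `m / 4` and threshold `ε m / 2` give the bound `1 / (ε² m) ≤ 1/2`.
  have hcheb := ProbabilityTheory.meas_ge_le_variance_div_sq hSL (c := ε * m / 2) (by positivity)
  rw [hmean] at hcheb
  have hcheb2 : (Measure.pi fun _ : Fin m => ν) {x | ε * m / 2 ≤ |S x - m * ν.real (Set.Iic v)|}
      ≤ 2⁻¹ := by
    refine hcheb.trans ?_
    rw [show (2⁻¹ : ENNReal) = ENNReal.ofReal (1 / 2) by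
      rw [one_div, ENNReal.ofReal_inv_of_pos (by norm_num)]; norm_num]
    refine ENNReal.ofReal_le_ofReal ?_
    rw [div_le_iff₀ (by positivity)]
    nlinarith
  have hcover : (1 : ENNReal) ≤ (Measure.pi fun _ : Fin m => ν)
      {x | |dominatedFraction x v - ν.real (Set.Iic v)| ≤ ε / 2} + 2⁻¹ := by
    rw [← measure_univ (μ := Measure.pi fun _ : Fin m => ν)]
    refine (measure_mono ?_).trans ((measure_union_le _ _).trans
      (add_le_add_right hcheb2 _))
    intro x _
    by_cases hx : |dominatedFraction x v - ν.real (Set.Iic v)| ≤ ε / 2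
    · exact Or.inl hx
    · refine Or.inr ?_
      push Not at hx
      have : S x - m * ν.real (Set.Iic v) = m * (dominatedFraction x v - ν.real (Set.Iic v)) := by
        rw [hSapp, dominatedFraction_eq_sum]; field_simp
      rw [Set.mem_ofPred_eq, this, abs_mul, abs_of_pos hmpos]
      nlinarith
  have h2 : (2⁻¹ : ENNReal) + 2⁻¹ = 1 := ENNReal.inv_two_add_inv_two
  rw [← h2] at hcover
  exact (ENNReal.add_le_add_iff_right (by norm_num)).1 hcover

/-- Exchange `inl i` and `inr i` whenever `σ i` is false. -/
def swapHalves {ι : Type*} (σ : ι → Bool) : Equiv.Perm (ι ⊕ ι) :=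
  Function.Involutive.toPerm
    (Sum.elim (fun i => if σ i then .inl i else .inr i) (fun i => if σ i then .inr i else .inl i))
    (by rintro (i | i) <;> by_cases h : σ i <;> simp [h])

@[simp]
theorem swapHalves_inl {ι : Type*} (σ : ι → Bool) (i : ι) :
    swapHalves σ (.inl i) = if σ i then .inl i else .inr i := rfl

@[simp]
theorem swapHalves_inr {ι : Type*} (σ : ι → Bool) (i : ι) :
    swapHalves σ (.inr i) = if σ i then .inr i else .inl i := rfl

theorem measurePreserving_comp_perm {V X : Type*} [Fintype V] [MeasurableSpace X] (ν : Measure X)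
    [SigmaFinite ν] (e : Equiv.Perm V) :
    MeasurePreserving (fun z : V → X => z ∘ e) (Measure.pi fun _ => ν) (Measure.pi fun _ => ν) := by
  have h := measurePreserving_piCongrLeft (α := fun _ : V => X) (fun _ => ν) e.symm
  convert h using 1
  funext z i
  obtain ⟨j, rfl⟩ := e.symm.surjective i
  rw [MeasurableEquiv.coe_piCongrLeft, Equiv.piCongrLeft_apply_apply]
  simp

open scoped Classical in
/-- The difference between the numbers of dominated points in the two halves of the sample. -/
noncomputable def halvesDifference {m k : ℕ} (z : Fin m ⊕ Fin m → Fin k → ℝ) (v : Fin k → ℝ) : ℝ :=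
  ∑ i, ((if z (.inl i) ≤ v then (1 : ℝ) else 0) - if z (.inr i) ≤ v then 1 else 0)

theorem measurable_halvesDifference {m k : ℕ} (v : Fin k → ℝ) :
    Measurable fun z : Fin m ⊕ Fin m → Fin k → ℝ => halvesDifference z v :=
  Finset.measurable_sum _ fun i _ =>
    (measurable_indicator_le (measurable_pi_apply (Sum.inl i)) v).sub
      (measurable_indicator_le (measurable_pi_apply (Sum.inr i)) v)

/-- Rational thresholds make the event a countable union of measurable sets. -/
theorem measurableSet_halvesDifference {m k : ℕ} (c : ℝ) :
    MeasurableSet {z : Fin m ⊕ Fin m → Fin k → ℝ |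
      ∃ q : Fin k → ℚ, c ≤ |halvesDifference z fun i => q i|} := by
  rw [Set.ofPred_exists]
  refine MeasurableSet.iUnion fun q => ?_
  exact measurableSet_le measurable_const (measurable_halvesDifference _).abs

theorem halvesDifference_comp_swapHalves {m k : ℕ} (z : Fin m ⊕ Fin m → Fin k → ℝ)
    (v : Fin k → ℝ) (σ : Fin m → Bool) {S : Finset (Fin m ⊕ Fin m)} (hS : ∀ i, i ∈ S ↔ z i ≤ v) :
    halvesDifference (z ∘ swapHalves σ) v = signedDiscrepancy σ S := by
  refine Finset.sum_congr rfl fun i _ => ?_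
  have hl := hS (.inl i)
  have hr := hS (.inr i)
  by_cases h : σ i <;> by_cases hl' : z (.inl i) ≤ v <;> by_cases hr' : z (.inr i) ≤ v <;>
    simp [h, hl, hr, hl', hr']

/-- The double sample is exchangeable, so swapping its halves according to any `σ` preserves the
probability. Averaging over `σ` and exchanging sum and integral reduces the bound to the count of
bad sign vectors for each fixed `z`. -/
theorem measure_halvesDifference_le {m k : ℕ} (hk : 0 < k) {ε δ : ℝ} (hε : 0 < ε) (hδ : 0 < δ)
    (hδ1 : δ < 1) (hm : 11520 * (k + Real.log (1 / δ)) ≤ ε ^ 2 * m)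
    (ν : Measure (Fin k → ℝ)) [IsProbabilityMeasure ν] :
    (Measure.pi fun _ : Fin m ⊕ Fin m => ν)
      {z | ∃ q : Fin k → ℚ, ε * m / 2 ≤ |halvesDifference z fun i => q i|}
      ≤ ENNReal.ofReal (δ / 2) := by
  classical
  set G := {z : Fin m ⊕ Fin m → Fin k → ℝ |
    ∃ q : Fin k → ℚ, ε * m / 2 ≤ |halvesDifference z fun i => q i|} with hG
  have hGm : MeasurableSet G := measurableSet_halvesDifference _
  set π := (Measure.pi fun _ : Fin m ⊕ Fin m => ν) with hπ
  have hpres : ∀ σ : Fin m → Bool, π ((fun z => z ∘ swapHalves σ) ⁻¹' G) = π G := fun σ =>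
    (measurePreserving_comp_perm ν (swapHalves σ)).measure_preimage hGm.nullMeasurableSet
  have hmeas : ∀ σ : Fin m → Bool, MeasurableSet ((fun z => z ∘ swapHalves σ) ⁻¹' G) := fun σ =>
    (measurePreserving_comp_perm ν (swapHalves σ)).measurable hGm
  have hpt : ∀ z, ∑ σ : Fin m → Bool, ((fun z => z ∘ swapHalves σ) ⁻¹' G).indicator 1 z
      ≤ ENNReal.ofReal (2 ^ m * (δ / 2)) := by
    intro z
    have h := card_exists_signedDiscrepancy_le (ι := Fin m) hk hε hδ hδ1 (by simpa using hm) z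
      (Finset.univ.filter (IsOrthantTrace z)) (fun A hA => (Finset.mem_filter.1 hA).2)
    rw [Fintype.card_fin] at h
    simp_rw [Set.indicator_apply, Pi.one_apply]
    rw [Finset.sum_boole, ← ENNReal.ofReal_natCast]
    refine ENNReal.ofReal_le_ofReal (le_trans (Nat.cast_le.2 (Finset.card_le_card ?_)) h)
    intro σ hσ
    obtain ⟨q, hq⟩ := (Finset.mem_filter.1 hσ).2
    refine Finset.mem_filter.2 ⟨Finset.mem_univ _,
      Finset.univ.filter (fun i => z i ≤ fun i => (q i : ℝ)), ?_, ?_⟩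
    · exact Finset.mem_filter.2 ⟨Finset.mem_univ _, fun i => (q i : ℝ), fun i => by simp⟩
    · rwa [← halvesDifference_comp_swapHalves z (fun i => (q i : ℝ)) σ (fun i => by simp)]
  have hsum : (2 : ENNReal) ^ m * π G ≤ ENNReal.ofReal (2 ^ m * (δ / 2)) := by
    calc (2 : ENNReal) ^ m * π G
        = ∑ σ : Fin m → Bool, π ((fun z => z ∘ swapHalves σ) ⁻¹' G) := by
          simp_rw [hpres]; simp
      _ = ∫⁻ z, ∑ σ : Fin m → Bool, ((fun z => z ∘ swapHalves σ) ⁻¹' G).indicator 1 z ∂π := by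
          rw [lintegral_finsetSum _ fun σ _ => measurable_one.indicator (hmeas σ)]
          exact Finset.sum_congr rfl fun σ _ => (lintegral_indicator_one (hmeas σ)).symm
      _ ≤ ∫⁻ _z, ENNReal.ofReal (2 ^ m * (δ / 2)) ∂π := lintegral_mono hpt
      _ = _ := by simp
  rw [ENNReal.ofReal_mul (by positivity), ENNReal.ofReal_pow (by norm_num),
    ENNReal.ofReal_ofNat] at hsum
  exact (ENNReal.mul_le_mul_iff_right (by positivity) (by finiteness)).1 hsum

theorem measurable_dominatedFraction {m k : ℕ} (v : Fin k → ℝ) :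
    Measurable fun x : Fin m → Fin k → ℝ => dominatedFraction x v := by
  simp_rw [dominatedFraction_eq_sum]
  exact (Finset.measurable_sum _ fun i _ =>
    measurable_indicator_le (measurable_pi_apply i) v).div_const _

/-- Symmetrization. -/
theorem measure_exists_rat_dominatedFraction_le {m k : ℕ} (hk : 0 < k) {ε δ : ℝ} (hε : 0 < ε)
    (hδ : 0 < δ) (hδ1 : δ < 1) (hm : 11520 * (k + Real.log (1 / δ)) ≤ ε ^ 2 * m)
    (ν : Measure (Fin k → ℝ)) [IsProbabilityMeasure ν] :
    (Measure.pi fun _ : Fin m => ν) {x | ∃ q : Fin k → ℚ,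
      ε < |dominatedFraction x (fun i => (q i : ℝ)) - ν.real (Set.Iic fun i => (q i : ℝ))|}
      ≤ ENNReal.ofReal δ := by
  have hk1 : (1 : ℝ) ≤ k := by exact_mod_cast hk
  have hΛ : 0 ≤ Real.log (1 / δ) := Real.log_nonneg (by rw [le_div_iff₀ hδ]; linarith)
  have hmpos : (0 : ℝ) < m := by
    by_contra! h
    have : ε ^ 2 * m ≤ 0 := mul_nonpos_of_nonneg_of_nonpos (by positivity) h
    linarith
  set B := {x : Fin m → Fin k → ℝ | ∃ q : Fin k → ℚ,
      ε < |dominatedFraction x (fun i => (q i : ℝ)) - ν.real (Set.Iic fun i => (q i : ℝ))|} with hB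
  have hBm : MeasurableSet B := by
    rw [hB, Set.ofPred_exists]
    exact MeasurableSet.iUnion fun q => measurableSet_lt measurable_const
      ((measurable_dominatedFraction _).sub_const _).abs
  set G := {z : Fin m ⊕ Fin m → Fin k → ℝ |
    ∃ q : Fin k → ℚ, ε * m / 2 ≤ |halvesDifference z fun i => q i|} with hG
  have hGm : MeasurableSet G := measurableSet_halvesDifference _
  have hGle := measure_halvesDifference_le hk hε hδ hδ1 hm ν
  set π := (Measure.pi fun _ : Fin m => ν) with hπ
  have hpres := measurePreserving_sumPiEquivProdPi_symm
    (X := fun _ : Fin m ⊕ Fin m => Fin k → ℝ) (fun _ => ν)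
  have hGprod := hpres.measure_preimage hGm.nullMeasurableSet
  rw [← hGprod, Measure.prod_apply (hpres.measurable hGm)] at hGle
  -- If the first half deviates by more than `ε` at `q`, then with probability at least `1/2` the
  -- ghost half is within `ε / 2` of the truth at the same `q`, and the halves differ by at least `ε
  -- m / 2`. Integration over `B` costs the factor `2`.
  have hslice : ∀ x ∈ B, 2⁻¹ ≤ π (Prod.mk x ⁻¹'
      ((MeasurableEquiv.sumPiEquivProdPi fun _ : Fin m ⊕ Fin m => Fin k → ℝ).symm ⁻¹' G)) := by
    rintro x ⟨q, hq⟩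
    refine (half_le_measure_dominatedFraction hε (by linarith) ν (fun i => (q i : ℝ))).trans
      (measure_mono fun y hy => ⟨q, ?_⟩)
    have hd : halvesDifference ((MeasurableEquiv.sumPiEquivProdPi
        fun _ : Fin m ⊕ Fin m => Fin k → ℝ).symm (x, y)) (fun i => (q i : ℝ))
        = m * (dominatedFraction x (fun i => (q i : ℝ))
          - dominatedFraction y (fun i => (q i : ℝ))) := by
      rw [dominatedFraction_eq_sum, dominatedFraction_eq_sum, ← sub_div,
        mul_div_cancel₀ _ hmpos.ne', ← Finset.sum_sub_distrib]
      rfl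
    rw [hd, abs_mul, abs_of_pos hmpos]
    have h3 := abs_sub_le (dominatedFraction x (fun i => (q i : ℝ)))
      (dominatedFraction y (fun i => (q i : ℝ))) (ν.real (Set.Iic fun i => (q i : ℝ)))
    have hy' : |dominatedFraction y (fun i => (q i : ℝ)) - ν.real (Set.Iic fun i => (q i : ℝ))|
      ≤ ε / 2 := hy
    nlinarith
  have hhalf : 2⁻¹ * π B ≤ ENNReal.ofReal (δ / 2) := by
    refine le_trans ?_ hGle
    calc 2⁻¹ * π B = ∫⁻ _x in B, 2⁻¹ ∂π := by simp
      _ ≤ ∫⁻ x in B, π (Prod.mk x ⁻¹' ((MeasurableEquiv.sumPiEquivProdPi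
            fun _ : Fin m ⊕ Fin m => Fin k → ℝ).symm ⁻¹' G)) ∂π :=
          setLIntegral_mono' hBm hslice
      _ ≤ _ := setLIntegral_le_lintegral _ _
  rw [div_eq_inv_mul, ENNReal.ofReal_mul (by norm_num),
    ENNReal.ofReal_inv_of_pos (by norm_num), ENNReal.ofReal_ofNat] at hhalf
  exact (ENNReal.mul_le_mul_iff_right (by norm_num) (by norm_num)).1 hhalf

/-! ### From rational to real thresholds, and from `ν` to the samples of `f`. -/

/-- The law of `f (Q)`, as a distribution on `ℝ^k`, has the same distribution function. -/
theorem statCDF_eq_map {n d k : ℕ} {μ : Fin n → Measure (EuclideanSpace ℝ (Fin d))}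
    {f : (Fin n → EuclideanSpace ℝ (Fin d)) → (Fin k → ℝ)} (hf : AEMeasurable f (Measure.pi μ))
    (v : Fin k → ℝ) : statCDF μ f v = ((Measure.pi μ).map f).real (Set.Iic v) := by
  rw [statCDF, measureReal_def, measureReal_def, Measure.map_apply_of_aemeasurable hf
    measurableSet_Iic]
  rfl

/-- A deviation at some `v` forces a deviation at some rational point. -/
theorem exists_rat_lt_abs_sub {m k : ℕ} {ε : ℝ} (ν : Measure (Fin k → ℝ))
    [IsProbabilityMeasure ν] (x : Fin m → Fin k → ℝ) (v : Fin k → ℝ)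
    (hv : ε < |dominatedFraction x v - ν.real (Set.Iic v)|) :
    ∃ q : Fin k → ℚ,
      ε < |dominatedFraction x (fun i => (q i : ℝ)) - ν.real (Set.Iic fun i => (q i : ℝ))| := by
  -- Along `w j ↓ v` the distribution function converges, by continuity from above, and the
  -- dominated fraction is eventually constant, since it involves finitely many points. A rational
  -- point between `v` and `w j` inherits both by monotonicity.
  set w : ℕ → Fin k → ℝ := fun j i => v i + 1 / ((j : ℝ) + 1) with hw
  have hwanti : Antitone w := fun a b hab i => by
    simp only [hw]
    have : (a : ℝ) ≤ b := by exact_mod_cast hab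
    gcongr
  have hwlim : ∀ y : Fin k → ℝ, (∀ j, y ≤ w j) → y ≤ v := fun y hy i => by
    have h1 : Filter.Tendsto (fun j => w j i) Filter.atTop (nhds (v i)) := by
      simpa [hw] using tendsto_const_nhds (x := v i) |>.add
        (tendsto_one_div_add_atTop_nhds_zero_nat (𝕜 := ℝ))
    exact ge_of_tendsto' h1 fun j => hy j i
  have hvw : ∀ j, v ≤ w j := fun j i => by
    simp only [hw]
    have : (0 : ℝ) < 1 / ((j : ℝ) + 1) := by positivity
    linarith
  have hF : Filter.Tendsto (fun j => ν.real (Set.Iic (w j))) Filter.atTop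
      (nhds (ν.real (Set.Iic v))) := by
    have h := tendsto_measure_iInter_atTop (μ := ν) (s := fun j => Set.Iic (w j))
      (fun j => measurableSet_Iic.nullMeasurableSet)
      (fun a b hab => Set.Iic_subset_Iic.2 (hwanti hab)) ⟨0, measure_ne_top _ _⟩
    have hI : ⋂ j, Set.Iic (w j) = Set.Iic v := by
      ext y
      simp only [Set.mem_iInter, Set.mem_Iic]
      exact ⟨hwlim y, fun hy j => hy.trans (hvw j)⟩
    rw [hI] at h
    exact (ENNReal.tendsto_toReal (measure_ne_top _ _)).comp h
  have hdom : ∀ᶠ j in Filter.atTop, dominatedFraction x (w j) = dominatedFraction x v := by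
    have h : ∀ i, ∀ᶠ j in Filter.atTop, (x i ≤ w j ↔ x i ≤ v) := fun i => by
      by_cases hi : x i ≤ v
      · exact Filter.Eventually.of_forall fun j => ⟨fun _ => hi, fun h => h.trans (hvw j)⟩
      · obtain ⟨j, hj⟩ : ∃ j, ¬ x i ≤ w j := by
          by_contra! hcon
          exact hi (hwlim _ hcon)
        filter_upwards [Filter.eventually_ge_atTop j] with j' hj'
        exact ⟨fun h => absurd (h.trans (hwanti hj')) hj, fun h => absurd h hi⟩
    filter_upwards [Filter.eventually_all.2 h] with j hj
    rw [dominatedFraction, dominatedFraction]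
    simp_rw [hj]
  set γ := |dominatedFraction x v - ν.real (Set.Iic v)| - ε with hγ
  obtain ⟨j, hj1, hj2⟩ := (hdom.and
    (hF.eventually_lt_const (show ν.real (Set.Iic v) < ν.real (Set.Iic v) + γ by linarith))).exists
  choose q hq1 hq2 using fun i => exists_rat_btwn (show v i < w j i by
    simp only [hw]
    have : (0 : ℝ) < 1 / ((j : ℝ) + 1) := by positivity
    linarith)
  have hvq : v ≤ fun i => (q i : ℝ) := fun i => (hq1 i).le
  have hqw : (fun i => (q i : ℝ)) ≤ w j := fun i => (hq2 i).le
  refine ⟨q, ?_⟩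
  have hd : dominatedFraction x (fun i => (q i : ℝ)) = dominatedFraction x v :=
    le_antisymm ((dominatedFraction_mono x hqw).trans_eq hj1) (dominatedFraction_mono x hvq)
  have hF1 : ν.real (Set.Iic v) ≤ ν.real (Set.Iic fun i => (q i : ℝ)) :=
    measureReal_mono (Set.Iic_subset_Iic.2 hvq)
  have hF2 : ν.real (Set.Iic fun i => (q i : ℝ)) ≤ ν.real (Set.Iic (w j)) :=
    measureReal_mono (Set.Iic_subset_Iic.2 hqw)
  rw [hd]
  have h3 := abs_sub_le (dominatedFraction x v) (ν.real (Set.Iic fun i => (q i : ℝ)))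
    (ν.real (Set.Iic v))
  rw [abs_of_nonneg (sub_nonneg.2 hF1)] at h3
  linarith

theorem measure_not_isQuantization_le {m k : ℕ} (hk : 0 < k) {ε δ : ℝ} (hε : 0 < ε)
    (hδ : 0 < δ) (hδ1 : δ < 1) (hm : 11520 * (k + Real.log (1 / δ)) ≤ ε ^ 2 * m)
    (ν : Measure (Fin k → ℝ)) [IsProbabilityMeasure ν] :
    (Measure.pi fun _ : Fin m => ν) {x | ¬ IsQuantization ε (fun v => ν.real (Set.Iic v)) x}
      ≤ ENNReal.ofReal δ := by
  have hk1 : (1 : ℝ) ≤ k := by exact_mod_cast hk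
  have hΛ : 0 ≤ Real.log (1 / δ) := Real.log_nonneg (by rw [le_div_iff₀ hδ]; linarith)
  have hmpos : 0 < m := by
    by_contra! h
    obtain rfl : m = 0 := by omega
    rw [Nat.cast_zero, mul_zero] at hm
    linarith
  refine (measure_mono fun x hx => ?_).trans
    (measure_exists_rat_dominatedFraction_le hk hε hδ hδ1 hm ν)
  have hx' : ¬ IsQuantization ε (fun v => ν.real (Set.Iic v)) x := hx
  rw [IsQuantization] at hx'
  push Not at hx'
  obtain ⟨v, hv⟩ := hx' hmpos
  exact exists_rat_lt_abs_sub ν x v hv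

/-- `m` independent samples fail to form an `ε`-quantization with probability at most `δ`. -/
theorem measure_pi_not_isQuantization_le {n d m k : ℕ} (hk : 0 < k) {ε δ : ℝ} (hε : 0 < ε)
    (hδ : 0 < δ) (hδ1 : δ < 1) (hm : 11520 * (k + Real.log (1 / δ)) ≤ ε ^ 2 * m)
    (μ : Fin n → Measure (EuclideanSpace ℝ (Fin d))) [∀ i, IsProbabilityMeasure (μ i)]
    {f : (Fin n → EuclideanSpace ℝ (Fin d)) → (Fin k → ℝ)} (hf : AEMeasurable f (Measure.pi μ)) :
    (Measure.pi fun _ : Fin m => Measure.pi μ)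
      {Q | ¬ IsQuantization ε (statCDF μ f) fun i => f (Q i)} ≤ ENNReal.ofReal δ := by
  have hprob : IsProbabilityMeasure ((Measure.pi μ).map f) := Measure.isProbabilityMeasure_map hf
  have hmap := Measure.pi_map_pi (μ := fun _ : Fin m => Measure.pi μ) (f := fun _ => f)
    (fun _ => hf)
  have hae : AEMeasurable (fun (Q : Fin m → Fin n → EuclideanSpace ℝ (Fin d)) i => f (Q i))
      (Measure.pi fun _ : Fin m => Measure.pi μ) :=
    aemeasurable_pi_lambda _ fun i =>
      hf.comp_quasiMeasurePreserving (measurePreserving_eval _ i).quasiMeasurePreserving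
  have h := measure_not_isQuantization_le hk hε hδ hδ1 hm ((Measure.pi μ).map f)
  rw [← hmap] at h
  -- This inequality for push-forwards holds for arbitrary sets, so the failure event need not be
  -- measurable.
  refine le_trans ?_ ((Measure.le_map_apply hae _).trans h)
  refine measure_mono fun Q hQ => ?_
  have : statCDF μ f = fun v => ((Measure.pi μ).map f).real (Set.Iic v) :=
    funext fun v => statCDF_eq_map hf v
  rw [this] at hQ
  exact hQ

/-- Links the infinite random tape of the machine to the finite sample: the algorithm reads only the
first `m` rows. -/
theorem infinitePi_map_fin {X : Type*} [MeasurableSpace X] (π : Measure X)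
    [IsProbabilityMeasure π] (m : ℕ) :
    (Measure.infinitePi fun _ : ℕ => π).map (fun ω (i : Fin m) => ω i)
      = Measure.pi fun _ : Fin m => π := by
  refine (Measure.pi_eq fun s hs => ?_).symm
  rw [Measure.map_apply (by fun_prop) (MeasurableSet.univ_pi hs)]
  have hset : (fun (ω : ℕ → X) (i : Fin m) => ω i) ⁻¹' Set.univ.pi s
      = Set.pi (Finset.range m) fun j => if h : j < m then s ⟨j, h⟩ else Set.univ := by
    ext ω
    simp only [Set.mem_preimage, Set.mem_pi, Set.mem_univ, true_imp_iff, Finset.coe_range,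
      Set.mem_Iio]
    constructor
    · intro h j hj
      simpa [hj] using h ⟨j, hj⟩
    · intro h i
      simpa using h i i.2
  rw [hset, Measure.infinitePi_pi _ fun j hj => ?_]
  · rw [Finset.prod_range]
    simp
  · split_ifs with h
    exacts [hs _, MeasurableSet.univ]

theorem measure_infinitePi_not_isQuantization_le {n d m k : ℕ} (hk : 0 < k) {ε δ : ℝ}
    (hε : 0 < ε) (hδ : 0 < δ) (hδ1 : δ < 1)
    (hm : 11520 * (k + Real.log (1 / δ)) ≤ ε ^ 2 * m)
    (μ : Fin n → Measure (EuclideanSpace ℝ (Fin d))) [∀ i, IsProbabilityMeasure (μ i)]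
    {f : (Fin n → EuclideanSpace ℝ (Fin d)) → (Fin k → ℝ)} (hf : AEMeasurable f (Measure.pi μ)) :
    (Measure.infinitePi fun _ : ℕ => Measure.pi μ)
      {ω | ¬ IsQuantization ε (statCDF μ f) fun i : Fin m => f (ω i)} ≤ ENNReal.ofReal δ := by
  have h := measure_pi_not_isQuantization_le hk hε hδ hδ1 hm μ hf
  rw [← infinitePi_map_fin (Measure.pi μ) m] at h
  exact (Measure.le_map_apply
    (measurable_pi_lambda _ fun i => measurable_pi_apply _).aemeasurable _).trans h

/-- Only subadditivity is used, so `p` need not define a measurable event. -/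
theorem one_sub_le_measureReal_of_compl {Ω : Type*} [MeasurableSpace Ω] (P : Measure Ω)
    [IsProbabilityMeasure P] {δ : ℝ} (hδ : 0 ≤ δ) {p : Ω → Prop}
    (h : P {x | ¬ p x} ≤ ENNReal.ofReal δ) : 1 - δ ≤ P.real {x | p x} := by
  have h1 : P.real {x | ¬ p x} ≤ δ := ENNReal.toReal_le_of_le_ofReal hδ h
  have h2 := measureReal_union_le (μ := P) {x | p x} {x | ¬ p x}
  have h3 : {x | p x} ∪ {x | ¬ p x} = Set.univ := by
    ext x; simp [em]
  rw [h3, probReal_univ] at h2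
  linarith

/-! ### The program and its correctness. -/

namespace RealRAM

section Runs

variable {n d k : ℕ} {f : (Fin n → EuclideanSpace ℝ (Fin d)) → (Fin k → ℝ)} {T : ℕ}
  {ω : ℕ → Fin n → EuclideanSpace ℝ (Fin d)}

/-- Started in `s`, the program `p` halts within time `B` in a state that satisfies `Q`. -/
def Runs (f : (Fin n → EuclideanSpace ℝ (Fin d)) → (Fin k → ℝ)) (T : ℕ)
    (ω : ℕ → Fin n → EuclideanSpace ℝ (Fin d)) (p : Prog) (s : State d) (B : ℕ)
    (Q : State d → Prop) : Prop :=
  ∃ t s', Exec f T ω p s t s' ∧ t ≤ B ∧ Q s'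

theorem Runs.instr {i : Instr} {s : State d} {Q : State d → Prop} (h : Q (i.apply f ω s)) :
    Runs f T ω (.instr i) s (i.cost T) Q :=
  ⟨_, _, .instr i s, le_rfl, h⟩

theorem Runs.seq {p q : Prog} {s : State d} {B B' : ℕ} {R Q : State d → Prop}
    (hp : Runs f T ω p s B R) (hq : ∀ s', R s' → Runs f T ω q s' B' Q) :
    Runs f T ω (.seq p q) s (B + B') Q := by
  obtain ⟨t, s', h, ht, hR⟩ := hp
  obtain ⟨t', s'', h', ht', hQ⟩ := hq s' hR
  exact ⟨_, _, .seq h h', add_le_add ht ht', hQ⟩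

/-- Sequencing after a single instruction. -/
theorem Runs.instr_seq {i : Instr} {q : Prog} {s : State d} {B' : ℕ} {Q : State d → Prop}
    (hq : Runs f T ω q (i.apply f ω s) B' Q) :
    Runs f T ω (.seq (.instr i) q) s (i.cost T + B') Q := by
  obtain ⟨t, s', h, ht, hQ⟩ := hq
  exact ⟨_, _, .seq (.instr i s) h, by omega, hQ⟩

theorem Runs.mono {p : Prog} {s : State d} {B B' : ℕ} {Q Q' : State d → Prop}
    (h : Runs f T ω p s B Q) (hB : B ≤ B') (hQ : ∀ s', Q s' → Q' s') : Runs f T ω p s B' Q' := by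
  obtain ⟨t, s', h, ht, hs⟩ := h
  exact ⟨t, s', h, ht.trans hB, hQ s' hs⟩

/-- A loop with invariant `I` that makes exactly `N` passes. -/
theorem Runs.loop {b : Test} {p : Prog} {B N : ℕ} (I : ℕ → State d → Prop)
    (hstep : ∀ i < N, ∀ s, I i s → b.Holds s ∧ Runs f T ω p s B (I (i + 1)))
    (hexit : ∀ s, I N s → ¬ b.Holds s) {s : State d} (hs : I 0 s) :
    Runs f T ω (.loop b p) s (N * (B + 1) + 1) (I N) := by
  -- Induction on the number `j` of passes still to be made.
  suffices h : ∀ j ≤ N, ∀ s, I (N - j) s → Runs f T ω (.loop b p) s (j * (B + 1) + 1) (I N) from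
    h N le_rfl s (by simpa using hs)
  intro j
  induction j with
  | zero => exact fun _ s hs => ⟨1, s, .loopStop (hexit s hs), by simp, hs⟩
  | succ j ih =>
    intro hj s hs
    obtain ⟨hb, t, s', he, ht, hI⟩ := hstep (N - (j + 1)) (by omega) s hs
    rw [show N - (j + 1) + 1 = N - j by omega] at hI
    obtain ⟨t', s'', he', ht', hI'⟩ := ih (by omega) s' hI
    refine ⟨_, _, .loopStep hb he he', ?_, hI'⟩
    rw [Nat.succ_mul]
    omega

end Runs

/-- Draw one point from each of the distributions. -/
def drawAll : Prog :=
  .seq (.instr (.natConst 4 0))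
    (.loop (.natLt 4 0) (.seq (.instr (.sample 4)) (.instr (.natAdd 4 4 5))))

/-- Count in natural register 6 how often `δ` has to be doubled until it reaches `1`. -/
def countDoublings : Prog :=
  .loop (.realLt 1 2) (.seq (.instr (.realAdd 1 1 1)) (.instr (.natAdd 6 6 5)))

/-- Evaluate the statistic on fresh samples until the counter reaches real register 3. -/
def collect : Prog :=
  .loop (.realLt 4 3) (.seq drawAll (.seq (.instr (.evalStat 3)) (.seq (.instr (.natAdd 3 3 1))
    (.seq (.instr (.natAdd 2 2 5)) (.instr (.realAdd 4 4 2))))))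

/-- The quantization algorithm: compute the sample size, then collect that many samples. -/
def quantize : Prog :=
  -- Natural registers: 2 counts the output points, 3 is the next free address, 5 holds the constant
  -- `1`, and 6 holds the number `L` of doublings, then `L + k`. Real registers: 2 holds `1`, 3
  -- receives the target `11520 (L + k) / ε²`, and 4 becomes the counter. The last instruction
  -- overwrites `n` in register 0, where the output size is read.
  .seq (.instr (.realConst 2 1)) (.seq (.instr (.natConst 5 1)) (.seq countDoublings
    (.seq (.instr (.natAdd 6 6 1)) (.seq (.instr (.realOfNat 3 6))
      (.seq (.instr (.realConst 4 11520)) (.seq (.instr (.realMul 3 3 4))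
        (.seq (.instr (.realDiv 3 3 0)) (.seq (.instr (.realDiv 3 3 0))
          (.seq (.instr (.realConst 4 0)) (.seq collect (.instr (.natCopy 0 2))))))))))))

section Correctness

variable {n d k : ℕ} {f : (Fin n → EuclideanSpace ℝ (Fin d)) → (Fin k → ℝ)} {T : ℕ}
  {ω : ℕ → Fin n → EuclideanSpace ℝ (Fin d)}

/-- Equal draw counts `i` make the round read exactly row `i` of the tape; the counts stay equal, so
successive rounds use successive, independent rows. -/
theorem runs_drawAll {s : State d} {i : ℕ} (h0 : s.nat 0 = n) (h5 : s.nat 5 = 1)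
    (hd : ∀ j < n, s.drawn j = i) :
    Runs f T ω drawAll s (3 * n + 2) fun s' =>
      (∀ r, r ≠ 4 → s'.nat r = s.nat r) ∧ s'.real = s.real ∧ s'.mem = s.mem ∧
      (∀ j < n, s'.drawn j = i + 1) ∧ ∀ j : Fin n, s'.pts j = ω i j := by
  have hloop := Runs.loop (f := f) (T := T) (ω := ω) (b := .natLt 4 0)
    (p := .seq (.instr (.sample 4)) (.instr (.natAdd 4 4 5))) (B := 2) (N := n)
    (fun j s' => s'.nat 4 = j ∧ (∀ r, r ≠ 4 → s'.nat r = s.nat r) ∧ s'.real = s.real ∧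
      s'.mem = s.mem ∧ (∀ l < n, s'.drawn l = if l < j then i + 1 else i) ∧
      ∀ l : Fin n, (l : ℕ) < j → s'.pts l = ω i l)
    (by
      rintro j hj s' ⟨h4, hnat, hreal, hmem, hdrawn, hpts⟩
      refine ⟨by simp [Test.Holds, h4, hnat 0 (by norm_num), h0, hj],
        Runs.instr_seq (B' := 1) (Runs.instr ?_)⟩
      have hj' : s'.nat 4 < n := by omega
      simp only [Instr.apply, hj', dif_pos]
      have hdj := hdrawn j hj
      simp only [lt_irrefl, if_false] at hdj
      refine ⟨by simp [h4, hnat 5 (by norm_num), h5], fun r hr => by simp [hr, hnat r hr],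
        hreal, hmem, fun l hl => ?_, fun l hl => ?_⟩
      · rcases eq_or_ne l j with rfl | hne
        · simp [h4, hdj]
        · have : l < j + 1 ↔ l < j := by omega
          simp [h4, hne, hdrawn l hl, this]
      · rcases eq_or_ne (l : ℕ) j with hlj | hne
        · have : (⟨j, hj⟩ : Fin n) = l := Fin.ext hlj.symm
          subst this
          simp [h4, hdj]
        · simp [h4, hne, hpts l (by omega)])
    (by
      rintro s' ⟨h4, hnat, -⟩
      simp [Test.Holds, h4, hnat 0 (by norm_num), h0])
    (s := (Instr.natConst 4 0).apply f ω s)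
    ⟨by simp [Instr.apply], fun r hr => by simp [Instr.apply, hr], rfl, rfl,
      fun l hl => by simpa [Instr.apply] using hd l hl, fun l hl => by simp at hl⟩
  refine (Runs.instr_seq hloop).mono (by simp only [Instr.cost]; omega) ?_
  rintro s' ⟨-, hnat, hreal, hmem, hdrawn, hpts⟩
  exact ⟨hnat, hreal, hmem, fun j hj => by simp [hdrawn j hj, hj], fun j => hpts j j.2⟩

theorem runs_countDoublings {ε δ : ℝ} {L : ℕ} (hlt : ∀ j < L, 2 ^ j * δ < 1)
    (hge : 1 ≤ 2 ^ L * δ) {s : State d} (h5 : s.nat 5 = 1) (h6 : s.nat 6 = 0)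
    (hr0 : s.real 0 = ε) (hr1 : s.real 1 = δ) (hr2 : s.real 2 = 1) :
    Runs f T ω countDoublings s (3 * L + 1) fun s' =>
      (∀ r, r ≠ 6 → s'.nat r = s.nat r) ∧ s'.nat 6 = L ∧ s'.real 0 = ε ∧ s'.real 2 = 1 ∧
      s'.drawn = s.drawn := by
  have hloop := Runs.loop (f := f) (T := T) (ω := ω) (b := .realLt 1 2)
    (p := .seq (.instr (.realAdd 1 1 1)) (.instr (.natAdd 6 6 5))) (B := 2) (N := L)
    (fun j s' => (∀ r, r ≠ 6 → s'.nat r = s.nat r) ∧ s'.nat 6 = j ∧ s'.real 0 = ε ∧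
      s'.real 1 = 2 ^ j * δ ∧ s'.real 2 = 1 ∧ s'.drawn = s.drawn)
    (by
      rintro j hj s' ⟨hnat, h6, hr0, hr1, hr2, hd⟩
      refine ⟨by simp [Test.Holds, hr1, hr2, hlt j hj],
        Runs.instr_seq (B' := 1) (Runs.instr ?_)⟩
      refine ⟨fun r hr => by simp [Instr.apply, hr, hnat r hr],
        by simp [Instr.apply, h6, hnat 5 (by norm_num), h5], by simp [Instr.apply, hr0],
        by simp [Instr.apply, hr1, pow_succ]; ring, by simp [Instr.apply, hr2], hd⟩)
    (by
      rintro s' ⟨-, -, -, hr1, hr2, -⟩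
      simp [Test.Holds, hr1, hr2, hge])
    (s := s) ⟨fun _ _ => rfl, h6, hr0, by simpa using hr1, hr2, rfl⟩
  refine hloop.mono (by omega) ?_
  rintro s' ⟨hnat, h6, hr0, -, hr2, hd⟩
  exact ⟨hnat, h6, hr0, hr2, hd⟩

/-- The loop compares a real counter with `x`, and `i < x` is equivalent to `i < ⌈x⌉₊`, so it makes
`⌈x⌉₊` passes without any rounding instruction. One pass with its test costs at most `3 n + T + 6 ≤
10 T`. -/
theorem runs_collect {x : ℝ} (hn : n ≤ T) (hT : 1 ≤ T) {s : State d} (h0 : s.nat 0 = n)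
    (h1 : s.nat 1 = k) (h2 : s.nat 2 = 0) (h3 : s.nat 3 = 0) (h5 : s.nat 5 = 1)
    (hr2 : s.real 2 = 1) (hr3 : s.real 3 = x) (hr4 : s.real 4 = 0) (hd : ∀ j < n, s.drawn j = 0) :
    Runs f T ω collect s (⌈x⌉₊ * (10 * T) + 1) fun s' => s'.nat 2 = ⌈x⌉₊ ∧
      (∀ j < n, s'.drawn j = ⌈x⌉₊) ∧
      ∀ a < ⌈x⌉₊, ∀ b : Fin k, s'.mem (a * k + b) = f (ω a) b := by
  have hloop := Runs.loop (f := f) (T := T) (ω := ω) (b := .realLt 4 3)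
    (p := .seq drawAll (.seq (.instr (.evalStat 3)) (.seq (.instr (.natAdd 3 3 1))
      (.seq (.instr (.natAdd 2 2 5)) (.instr (.realAdd 4 4 2))))))
    (B := 3 * n + 2 + (T + (1 + (1 + 1)))) (N := ⌈x⌉₊)
    (fun i s' => (s'.nat 0 = n ∧ s'.nat 1 = k ∧ s'.nat 2 = i ∧ s'.nat 3 = i * k ∧ s'.nat 5 = 1) ∧
      (s'.real 2 = 1 ∧ s'.real 3 = x ∧ s'.real 4 = i) ∧ (∀ j < n, s'.drawn j = i) ∧
      ∀ a < i, ∀ b : Fin k, s'.mem (a * k + b) = f (ω a) b)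
    (by
      rintro i hi s' ⟨⟨h0, h1, h2, h3, h5⟩, ⟨hr2, hr3, hr4⟩, hd, hmem⟩
      refine ⟨by simpa [Test.Holds, hr3, hr4] using Nat.lt_ceil.1 hi,
        (runs_drawAll h0 h5 hd).seq fun u hu => Runs.instr_seq (Runs.instr_seq
          (Runs.instr_seq (Runs.instr ?_)))⟩
      obtain ⟨hnat, hreal, humem, hudrawn, hupts⟩ := hu
      have e0 := hnat 0 (by norm_num)
      have e1 := hnat 1 (by norm_num)
      have e2 := hnat 2 (by norm_num)
      have e3 := hnat 3 (by norm_num)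
      have e5 := hnat 5 (by norm_num)
      have hpts : (fun j : Fin n => u.pts j) = ω i := funext hupts
      refine ⟨⟨by simp [Instr.apply, e0, h0], by simp [Instr.apply, e1, h1],
        by simp [Instr.apply, e2, h2, e5, h5], by simp [Instr.apply, e3, h3, e1, h1]; ring,
        by simp [Instr.apply, e5, h5]⟩, ⟨by simp [Instr.apply, hreal, hr2],
        by simp [Instr.apply, hreal, hr3], by simp [Instr.apply, hreal, hr4, hr2]⟩,
        fun j hj => by simp [Instr.apply, hudrawn j hj], fun a ha b => ?_⟩
      simp only [Instr.apply, e3, h3, hpts, humem]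
      rcases Nat.lt_succ_iff_lt_or_eq.1 ha with ha' | rfl
      -- Earlier points occupy cells below `i * k`, which the new evaluation does not touch.
      · have hlt : a * k + b < i * k := by
          have h := Nat.mul_le_mul_right k (Nat.succ_le_of_lt ha')
          rw [Nat.succ_mul] at h
          omega
        rw [dif_neg (by omega)]
        exact hmem a ha' b
      · rw [dif_pos ⟨by omega, by omega⟩]
        congr 1
        exact Fin.ext (by simp))
    (by
      rintro s' ⟨-, ⟨-, hr3, hr4⟩, -⟩
      simpa [Test.Holds, hr3, hr4] using Nat.le_ceil x)
    (s := s) ⟨⟨h0, h1, h2, by simpa using h3, h5⟩, ⟨hr2, hr3, by simpa using hr4⟩, hd,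
      fun a ha => by simp at ha⟩
  refine hloop.mono ?_ ?_
  · gcongr
    omega
  · rintro s' ⟨⟨-, -, h2, -⟩, -, hd, hmem⟩
    exact ⟨h2, hd, hmem⟩

theorem runs_quantize {ε δ : ℝ} {L : ℕ} (hlt : ∀ j < L, 2 ^ j * δ < 1) (hge : 1 ≤ 2 ^ L * δ)
    (hn : n ≤ T) (hT : 1 ≤ T) :
    Runs f T ω quantize (State.init n d k ε δ)
      (3 * L + ⌈((L + k : ℕ) : ℝ) * 11520 / ε / ε⌉₊ * (10 * T) + 12) fun s' =>
      s'.outCard = ⌈((L + k : ℕ) : ℝ) * 11520 / ε / ε⌉₊ ∧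
      (∀ j < n, s'.drawn j = ⌈((L + k : ℕ) : ℝ) * 11520 / ε / ε⌉₊) ∧
      ∀ a < ⌈((L + k : ℕ) : ℝ) * 11520 / ε / ε⌉₊, ∀ b : Fin k,
        s'.mem (a * k + b) = f (ω a) b := by
  set x : ℝ := ((L + k : ℕ) : ℝ) * 11520 / ε / ε with hx
  have hmain : Runs f T ω quantize (State.init n d k ε δ)
      (1 + (1 + ((3 * L + 1) + (1 + (1 + (1 + (1 + (1 + (1 + (1 +
        ((⌈x⌉₊ * (10 * T) + 1) + 1))))))))))) fun s' => s'.outCard = ⌈x⌉₊ ∧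
      (∀ j < n, s'.drawn j = ⌈x⌉₊) ∧
      ∀ a < ⌈x⌉₊, ∀ b : Fin k, s'.mem (a * k + b) = f (ω a) b := by
    refine Runs.instr_seq (Runs.instr_seq (Runs.seq
      (runs_countDoublings (ε := ε) (δ := δ) hlt hge ?_ ?_ ?_ ?_ ?_) fun u hu => ?_))
    · simp [Instr.apply]
    · simp [Instr.apply, State.init]
    · simp [Instr.apply, State.init]
    · simp [Instr.apply, State.init]
    · simp [Instr.apply, State.init]
    obtain ⟨hnat, h6, hr0, hr2, hd⟩ := hu
    have e0 : u.nat 0 = n := by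
      rw [hnat 0 (by norm_num)]; simp [Instr.apply, State.init]
    have e1 : u.nat 1 = k := by
      rw [hnat 1 (by norm_num)]; simp [Instr.apply, State.init]
    have e2 : u.nat 2 = 0 := by
      rw [hnat 2 (by norm_num)]; simp [Instr.apply, State.init]
    have e3 : u.nat 3 = 0 := by
      rw [hnat 3 (by norm_num)]; simp [Instr.apply, State.init]
    have e5 : u.nat 5 = 1 := by
      rw [hnat 5 (by norm_num)]; simp [Instr.apply]
    refine Runs.instr_seq (Runs.instr_seq (Runs.instr_seq (Runs.instr_seq (Runs.instr_seq
      (Runs.instr_seq (Runs.instr_seq (Runs.seq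
        (runs_collect (x := x) hn hT ?_ ?_ ?_ ?_ ?_ ?_ ?_ ?_ ?_) fun w hw => Runs.instr ?_)))))))
    · simp [Instr.apply, e0]
    · simp [Instr.apply, e1]
    · simp [Instr.apply, e2]
    · simp [Instr.apply, e3]
    · simp [Instr.apply, e5]
    · simp [Instr.apply, hr2]
    · simp [Instr.apply, h6, e1, hr0, hx]
    · simp [Instr.apply]
    · intro j _
      simp [Instr.apply, hd, State.init]
    · exact ⟨by simpa [Instr.apply, State.outCard] using hw.1, hw.2⟩
  exact hmain.mono (by omega) fun _ h => h

end Correctness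

theorem isQuantization_out_iff {d k m : ℕ} {ε : ℝ} {F : (Fin k → ℝ) → ℝ} {s : State d}
    (hs : s.outCard = m) {R : Fin m → Fin k → ℝ}
    (hmem : ∀ (a : Fin m) (b : Fin k), s.mem (a * k + b) = R a b) :
    IsQuantization ε F (s.out k) ↔ IsQuantization ε F R := by
  subst hs
  have : s.out k = R := funext fun a => funext fun b => hmem a b
  rw [this]

end RealRAM

/-! ### Size of the sample and assembly. -/

/-- For the least `L` with `2^L δ ≥ 1`, taking logarithms at `L` and at `L - 1` gives both bounds,
because `1/2 < log 2 < 1`. -/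
theorem exists_doublings {δ : ℝ} (hδ : 0 < δ) (hδ1 : δ < 1) :
    ∃ L : ℕ, (∀ j < L, 2 ^ j * δ < 1) ∧ 1 ≤ 2 ^ L * δ ∧
      Real.log (1 / δ) ≤ L ∧ (L : ℝ) ≤ 1 + 2 * Real.log (1 / δ) := by
  classical
  have hex : ∃ L : ℕ, 1 ≤ 2 ^ L * δ := by
    obtain ⟨L, hL⟩ := pow_unbounded_of_one_lt (1 / δ) (one_lt_two (α := ℝ))
    rw [div_lt_iff₀ hδ] at hL
    exact ⟨L, hL.le⟩
  have hmin : ∀ j < Nat.find hex, 2 ^ j * δ < 1 := fun j hj => not_le.1 (Nat.find_min hex hj)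
  have hlog1 := Real.log_two_gt_d9
  have hlog2 := Real.log_two_lt_d9
  have hΛ : 0 ≤ Real.log (1 / δ) := Real.log_nonneg (by rw [le_div_iff₀ hδ]; linarith)
  refine ⟨Nat.find hex, hmin, Nat.find_spec hex, ?_, ?_⟩
  · have h := Real.log_le_log (by positivity)
      ((div_le_iff₀ hδ).2 (Nat.find_spec hex))
    rw [Real.log_pow] at h
    have h0 : (0 : ℝ) ≤ Nat.find hex := Nat.cast_nonneg _
    nlinarith
  · rcases Nat.eq_zero_or_pos (Nat.find hex) with h0 | hpos
    · rw [h0, Nat.cast_zero]; linarith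
    · have h := hmin (Nat.find hex - 1) (by omega)
      rw [← lt_div_iff₀ hδ] at h
      have h2 := Real.log_le_log (by positivity) h.le
      rw [Real.log_pow, Nat.cast_sub hpos] at h2
      have h1 : (1 : ℝ) ≤ Nat.find hex := by exact_mod_cast hpos
      push_cast at h2
      nlinarith

/-- Since `k ≥ 1`, `L + k ≤ 2 (k + Λ)`. The rounding error and the additive overheads are absorbed
because `k + Λ`, `1 / ε²` and `T` are all at least `1`. -/
theorem sampleSize_bounds {k L T : ℕ} (hk : 0 < k) (hT : 1 ≤ T) {ε Λ : ℝ} (hε : 0 < ε)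
    (hε1 : ε < 1) (hΛ : 0 ≤ Λ) (h1 : Λ ≤ L) (h2 : (L : ℝ) ≤ 1 + 2 * Λ) {M : ℕ}
    (hM : M = ⌈((L + k : ℕ) : ℝ) * 11520 / ε / ε⌉₊) :
    11520 * (k + Λ) ≤ ε ^ 2 * M ∧ (M : ℝ) ≤ 23041 * ((1 / ε ^ 2) * (k + Λ)) ∧
      ((3 * L + M * (10 * T) + 12 : ℕ) : ℝ) ≤ 1000000 * (T * (1 / ε ^ 2) * (k + Λ)) := by
  have hk1 : (1 : ℝ) ≤ k := by exact_mod_cast hk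
  have hT1 : (1 : ℝ) ≤ T := by exact_mod_cast hT
  set U := (1 / ε ^ 2) * (k + Λ) with hU
  have hinv : 1 ≤ 1 / ε ^ 2 := by
    rw [le_div_iff₀ (by positivity)]; nlinarith
  have hkU : k + Λ ≤ U := by nlinarith
  have hx : ((L + k : ℕ) : ℝ) * 11520 / ε / ε = 11520 * ((1 / ε ^ 2) * (L + k)) := by
    push_cast; field_simp
  have hle := Nat.le_ceil (((L + k : ℕ) : ℝ) * 11520 / ε / ε)
  have hlt := Nat.ceil_lt_add_one (a := ((L + k : ℕ) : ℝ) * 11520 / ε / ε) (by positivity)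
  rw [← hM, hx] at hle hlt
  have hM2 : (M : ℝ) ≤ 23041 * U := by
    have : (1 / ε ^ 2) * ((L : ℝ) + k) ≤ (1 / ε ^ 2) * (2 * (k + Λ)) := by
      gcongr; linarith
    have h3 : (1 / ε ^ 2) * (2 * (k + Λ)) = 2 * U := by rw [hU]; ring
    linarith
  refine ⟨?_, hM2, ?_⟩
  · have h3 : ε ^ 2 * (11520 * ((1 / ε ^ 2) * ((L : ℝ) + k))) = 11520 * (L + k) := by
      field_simp
    have h4 := mul_le_mul_of_nonneg_left hle (sq_nonneg ε)
    linarith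
  · have h3 : (T : ℝ) * (1 / ε ^ 2) * (k + Λ) = T * U := by rw [hU]; ring
    rw [h3]
    have h4 : U ≤ T * U := le_mul_of_one_le_left (by linarith) hT1
    have h5 : (M : ℝ) * T ≤ 23041 * U * T := by gcongr
    push_cast
    linarith

/-- There are a universal constant `C` and one program `p` such that, for all `n`, `d`, `k ≥ 1`,
`ε, δ ∈ (0, 1)`, all distributions `μ 1, …, μ n` on `ℝ^d` and all statistics `f`:
at least `C (1/ε²) (k + log (1/δ))` independent samples of `f` form an `ε`-quantization with
probability at least `1 - δ`; and `p` halts within the stated time, with an output of the stated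
size, which is an `ε`-quantization with probability at least `1 - δ`. -/
theorem mainTheorem6 :
    ∃ C : ℝ, 0 < C ∧ ∃ p : RealRAM.Prog,
      ∀ (n d k : ℕ), 0 < k →
      ∀ (ε δ : ℝ), 0 < ε → ε < 1 → 0 < δ → δ < 1 →
      ∀ (μ : Fin n → Measure (EuclideanSpace ℝ (Fin d))) [∀ i, IsProbabilityMeasure (μ i)]
        (f : (Fin n → EuclideanSpace ℝ (Fin d)) → (Fin k → ℝ)), AEMeasurable f (Measure.pi μ) →
        (∀ m : ℕ, C * ((1 / ε ^ 2) * (k + Real.log (1 / δ))) ≤ m →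
          1 - δ ≤ (Measure.pi (fun _ : Fin m => Measure.pi μ)).real
            {Q | IsQuantization ε (statCDF μ f) (fun i => f (Q i))}) ∧
        (∀ T : ℕ, 1 ≤ T → n ≤ T →
          ∃ (time : (ℕ → Fin n → EuclideanSpace ℝ (Fin d)) → ℕ)
            (final : (ℕ → Fin n → EuclideanSpace ℝ (Fin d)) → RealRAM.State d),
            (∀ ω, RealRAM.Exec f T ω p (RealRAM.State.init n d k ε δ) (time ω) (final ω) ∧
              (time ω : ℝ) ≤ C * (T * (1 / ε ^ 2) * (k + Real.log (1 / δ))) ∧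
              (∀ j < n, ((final ω).drawn j : ℝ) ≤ C * ((1 / ε ^ 2) * (k + Real.log (1 / δ)))) ∧
              (((final ω).outCard * k : ℕ) : ℝ) ≤ C * ((k / ε ^ 2) * (k + Real.log (1 / δ)))) ∧
            1 - δ ≤ (Measure.infinitePi (fun _ : ℕ => Measure.pi μ)).real
              {ω | IsQuantization ε (statCDF μ f) ((final ω).out k)}) := by
  -- The constant must exceed `11520` for the sampling bound, `23041` for the sample size, and `10 *
  -- 23041` plus overhead for the running time.
  refine ⟨1000000, by norm_num, RealRAM.quantize, ?_⟩
  intro n d k hk ε δ hε hε1 hδ hδ1 μ _ f hf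
  have hΛ : 0 ≤ Real.log (1 / δ) := Real.log_nonneg (by rw [le_div_iff₀ hδ]; linarith)
  have hkΛ : 0 ≤ (k : ℝ) + Real.log (1 / δ) := by positivity
  refine ⟨fun m hm => ?_, fun T hT hn => ?_⟩
  · refine one_sub_le_measureReal_of_compl _ hδ.le
      (measure_pi_not_isQuantization_le hk hε hδ hδ1 ?_ μ hf)
    have h := mul_le_mul_of_nonneg_left hm (sq_nonneg ε)
    have h2 : ε ^ 2 * (1000000 * ((1 / ε ^ 2) * (k + Real.log (1 / δ))))
        = 1000000 * (k + Real.log (1 / δ)) := by field_simp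
    linarith
  · obtain ⟨L, hlt, hge, hL1, hL2⟩ := exists_doublings hδ hδ1
    obtain ⟨M, hM⟩ : ∃ M, M = ⌈((L + k : ℕ) : ℝ) * 11520 / ε / ε⌉₊ := ⟨_, rfl⟩
    obtain ⟨hm, hMle, htime⟩ := sampleSize_bounds hk hT hε hε1 hΛ hL1 hL2 hM
    have hrun := fun ω => RealRAM.runs_quantize (f := f) (ω := ω) (ε := ε) hlt hge hn hT
    rw [← hM] at hrun
    choose time final hexec hle hcard hdrawn hmem using hrun
    have hU : 0 ≤ (1 / ε ^ 2) * ((k : ℝ) + Real.log (1 / δ)) := by positivity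
    refine ⟨time, final, fun ω => ⟨hexec ω, (Nat.cast_le.2 (hle ω)).trans htime,
      fun j hj => ?_, ?_⟩, ?_⟩
    · rw [hdrawn ω j hj]
      linarith
    · rw [hcard ω, Nat.cast_mul]
      have h := mul_le_mul_of_nonneg_right hMle (Nat.cast_nonneg (α := ℝ) k)
      have h2 : (k / ε ^ 2) * (k + Real.log (1 / δ))
          = (1 / ε ^ 2) * (k + Real.log (1 / δ)) * k := by ring
      rw [h2]
      have h3 := mul_nonneg hU (Nat.cast_nonneg (α := ℝ) k)
      linarith
    · refine one_sub_le_measureReal_of_compl _ hδ.le (le_of_eq_of_le ?_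
        (measure_infinitePi_not_isQuantization_le (m := M) hk hε hδ hδ1 hm μ hf))
      congr 1
      ext ω
      exact not_congr (RealRAM.isQuantization_out_iff (hcard ω) fun a b => hmem ω a a.2 b)
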